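/- Let $(X_i,Y_i)_{i\ge 1}$ be i.i.d. copies of $(X,Y)$, where $X$ is a random vector in $\mathbb R^d$ and $Y$ is a real response. Consider one of the following four regression problems, with mean function $h=h(x;\beta_0,\beta)$ and loss $\ell=\ell(x,y;\beta_0,\beta)$: - linear: $h=\beta_0+\beta^\top x$, $\ell=(y-h)^2$, $Y\in\mathbb R$; - logistic: $h=(1+e^{-(\beta_0+\beta^\top x)})^{-1}$, $\ell=-\{y\log h+(1-y)\log(1-h)\}$, $Y\in\{0,1\}$ a.s.; - Poisson: $h=e^{\beta_0+\beta^\top x}$, $\ell=-\{y\log h-h-\log(y!)\}$, $Y\in\{0,1,2,\dots\}$ a.s.; - Gamma with fixed shape $\nu>0$: $h=e^{\beta_0+\beta^\top x}$, $\ell=-\{-\nu\log h+(\nu-1)\log y-y\nu/h\}$, $Y>0$ a.s. Assume the corresponding moment conditions: - linear: $\mathbb E\|X\|^4<\infty$ and $\mathbb E|Y|^4<\infty$; - logistic: $\mathbb E\|X\|^2<\infty$; - Poisson and Gamma: $X$ is Gaussian or sub-Gaussian (that is, for some $\sigma\ge 0$, $\mathbb E\,e^{t u^\top(X-\mathbb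 EX)}\le e^{\sigma^2t^2/2}$ for all unit vectors $u$ and all $t\in\mathbb R$) and $\mathbb E|Y|^4<\infty$; in the Gamma case with $\nu\neq 1$ also $\mathbb E|\log Y|<\infty$. Let $0\le a<b$, let $U\subset\mathbb R$ be compact and non-empty, and for $k\in[a,b]$ let $$\mathbb T_k=\{(\beta_0,\beta)\in U\times\mathbb R^d: g(\beta)\le k\},$$ where $g(\beta)$ is $\|\beta\|_1$ (Lasso), $\|\beta\|_2$ (Ridge), or $\alpha\|\beta\|_1+(1-\alpha)\|\beta\|_2^2$ for a fixed $\alpha\in(0,1)$ (elastic net). Put $$r(\theta)=\mathbb E\,\ell(X,Y;\theta),\qquad R_n(\theta)=\frac1n\sum_{i=1}^n\ell(X_i,Y_i;\theta),\qquad \theta=(\beta_0,\beta).$$ For $k\in[a,b]$ and $n\ge1$ let $P_{k,n}$ be random variables such that - $P_{k,n}>0$ almost surely, and $P_{k,n}\to0$ in probability as $n\to\infty$; - for $a\le k<l\le b$, $\sqrt n\,(P_{l,n}-P_{k,n})\to\infty$ in probability, i.e. $\mathbb P(\sqrt n\,(P_{l,n}-P_{k,n})\le M)\to0$ for every $M\in\mathbb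 R$; - for each $n\ge1$, almost surely $k\mapsto P_{k,n}$ is continuous and strictly increasing on $[a,b]$. Then $\ell(X,Y;\theta)$ is integrable for every $\theta$; for every $k\in[a,b]$ the functions $r$ and $R_n$ attain their minima on $\mathbb T_k$; the optimal index $$k^*=\min\ \operatorname*{arg\,min}_{k\in[a,b]}\ \min_{\theta\in\mathbb T_k}r(\theta)$$ exists; for each $n\ge1$ the PanIC estimator $$\hat K_n=\min\ \operatorname*{arg\,min}_{k\in[a,b]}\Big\{\min_{\theta\in\mathbb T_k}R_n(\theta)+P_{k,n}\Big\}$$ almost surely exists; and $\hat K_n\to k^*$ in probability: $\mathbb P(|\hat K_n-k^*|\ge\varepsilon)\to0$ as $n\to\infty$ for every $\varepsilon>0$. -/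

import Mathlib

open MeasureTheory ProbabilityTheory Filter Topology
open scoped ENNReal NNReal

noncomputable section

namespace PanIC

/-- The four regression problems. The Gamma regression has a fixed shape parameter `ν > 0`. -/
inductive Regression where
  | linear
  | logistic
  | poisson
  | gamma (ν : Set.Ioi (0 : ℝ))

/-- The three types of constraint; the elastic net has a fixed mixing weight `α ∈ (0, 1)`. -/
inductive Constraint where
  | lasso
  | ridge
  | elasticNet (α : Set.Ioo (0 : ℝ) 1)

/-- Parameters `(β₀, β)`: bias term and coefficient vector. -/
abbrev Param (d : ℕ) : Type := ℝ × EuclideanSpace ℝ (Fin d)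

/-- The set in which the response takes its values. -/
def Regression.responseSpace : Regression → Set ℝ
  | .linear => Set.univ
  | .logistic => {0, 1}
  | .poisson => Set.range (fun j : ℕ => (j : ℝ))
  | .gamma _ => Set.Ioi 0

/-- The linear predictor `β₀ + βᵀ x`. -/
def linearPredictor {d : ℕ} (θ : Param d) (x : EuclideanSpace ℝ (Fin d)) : ℝ :=
  θ.1 + ∑ i, θ.2 i * x i

/-- The mean function `h(x; β₀, β)`. -/
def Regression.mean {d : ℕ} (m : Regression) (θ : Param d) (x : EuclideanSpace ℝ (Fin d)) : ℝ :=
  match m with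
  | .linear => linearPredictor θ x
  | .logistic => (1 + Real.exp (-linearPredictor θ x))⁻¹
  | .poisson => Real.exp (linearPredictor θ x)
  | .gamma _ => Real.exp (linearPredictor θ x)

/-- The loss at response `y` and mean `h`. In the Poisson case `⌊y⌋₊.factorial` is `y!` for the
responses `y ∈ ℕ` that occur there. -/
def Regression.lossAt (m : Regression) (y h : ℝ) : ℝ :=
  match m with
  | .linear => (y - h) ^ 2
  | .logistic => -(y * Real.log h + (1 - y) * Real.log (1 - h))
  | .poisson => -(y * Real.log h - h - Real.log (Nat.factorial ⌊y⌋₊ : ℝ))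
  | .gamma ν => -(-(ν : ℝ) * Real.log h + ((ν : ℝ) - 1) * Real.log y - y * (ν : ℝ) / h)

/-- The loss `ℓ(x, y; β₀, β)`. -/
def Regression.loss {d : ℕ} (m : Regression) (x : EuclideanSpace ℝ (Fin d)) (y : ℝ)
    (θ : Param d) : ℝ :=
  m.lossAt y (m.mean θ x)

/-- The constrained quantity: `‖β‖₁`, `‖β‖₂`, or `α ‖β‖₁ + (1 - α) ‖β‖₂²`. -/
def Constraint.size {d : ℕ} (c : Constraint) (β : EuclideanSpace ℝ (Fin d)) : ℝ :=
  match c with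
  | .lasso => ∑ i, |β i|
  | .ridge => ‖β‖
  | .elasticNet α => (α : ℝ) * ∑ i, |β i| + (1 - (α : ℝ)) * ‖β‖ ^ 2

/-- The parameter space `T_k`, with bias terms in `U`. -/
def paramSpace {d : ℕ} (c : Constraint) (U : Set ℝ) (k : ℝ) : Set (Param d) :=
  {θ | θ.1 ∈ U ∧ c.size θ.2 ≤ k}

/-- A sub-Gaussian random vector: the one-dimensional marginals of the centred vector in all unit
directions are sub-Gaussian with a common variance proxy. -/
def IsSubGaussianVector {d : ℕ} {Ω : Type*} [MeasurableSpace Ω]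
    (X : Ω → EuclideanSpace ℝ (Fin d)) (μ : Measure Ω) : Prop :=
  ∃ c : ℝ≥0, ∀ u : EuclideanSpace ℝ (Fin d), ‖u‖ = 1 →
    HasSubgaussianMGF (fun ω => inner ℝ u (X ω - ∫ ω', X ω' ∂μ)) c μ

/-- The conditions on the covariate vector `X` and the response `Y` in each regression problem. In
the Gamma problem the term `(ν - 1) log Y` of the loss has to be integrable. -/
def Regression.MomentConditions {d : ℕ} {Ω : Type*} [MeasurableSpace Ω] (m : Regression)
    (X : Ω → EuclideanSpace ℝ (Fin d)) (Y : Ω → ℝ) (μ : Measure Ω) : Prop :=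
  match m with
  | .linear => Integrable (fun ω => ‖X ω‖ ^ 4) μ ∧ Integrable (fun ω => |Y ω| ^ 4) μ
  | .logistic => Integrable (fun ω => ‖X ω‖ ^ 2) μ
  | .poisson =>
      (HasGaussianLaw X μ ∨ IsSubGaussianVector X μ) ∧ Integrable (fun ω => |Y ω| ^ 4) μ
  | .gamma ν =>
      (HasGaussianLaw X μ ∨ IsSubGaussianVector X μ) ∧ Integrable (fun ω => |Y ω| ^ 4) μ ∧
        ((ν : ℝ) ≠ 1 → Integrable (fun ω => Real.log (Y ω)) μ)

/-- The empirical risk of the first `n` observations. -/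
def empiricalRisk {d : ℕ} {Ω : Type*} (m : Regression)
    (X : ℕ → Ω → EuclideanSpace ℝ (Fin d)) (Y : ℕ → Ω → ℝ) (n : ℕ) (ω : Ω) (θ : Param d) : ℝ :=
  (1 / (n : ℝ)) * ∑ i ∈ Finset.range n, m.loss (X i ω) (Y i ω) θ

/-- The expected risk `r(θ) = E ℓ(X, Y; θ)`. -/
def expectedRisk {d : ℕ} {Ω : Type*} [MeasurableSpace Ω] (m : Regression)
    (X : Ω → EuclideanSpace ℝ (Fin d)) (Y : Ω → ℝ) (μ : Measure Ω) (θ : Param d) : ℝ :=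
  ∫ ω, m.loss (X ω) (Y ω) θ ∂μ

/-- The minimum of `f` over `T` (the infimum, a minimum whenever it is attained). -/
def minOver {S : Type*} (T : Set S) (f : S → ℝ) : ℝ := sInf (f '' T)

/-- The set of minimizers of `V` over the index interval `[a, b]`. -/
def argminIcc (a b : ℝ) (V : ℝ → ℝ) : Set ℝ := {k | k ∈ Set.Icc a b ∧ IsMinOn V (Set.Icc a b) k}

/-- The set `𝒦` of indices with minimal optimal risk. -/
def optimalIndices {d : ℕ} {Ω : Type*} [MeasurableSpace Ω] (m : Regression) (c : Constraint)
    (U : Set ℝ) (a b : ℝ) (X : Ω → EuclideanSpace ℝ (Fin d)) (Y : Ω → ℝ) (μ : Measure Ω) :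
    Set ℝ :=
  argminIcc a b fun k => minOver (paramSpace c U k) (expectedRisk m X Y μ)

/-- The optimal hypothesis index `k* = min 𝒦`. -/
def optimalIndex {d : ℕ} {Ω : Type*} [MeasurableSpace Ω] (m : Regression) (c : Constraint)
    (U : Set ℝ) (a b : ℝ) (X : Ω → EuclideanSpace ℝ (Fin d)) (Y : Ω → ℝ) (μ : Measure Ω) : ℝ :=
  sInf (optimalIndices m c U a b X Y μ)

/-- The minimizers over `k ∈ [a, b]` of the penalized minimal empirical risk. -/
def panICIndices {d : ℕ} {Ω : Type*} (m : Regression) (c : Constraint) (U : Set ℝ) (a b : ℝ)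
    (X : ℕ → Ω → EuclideanSpace ℝ (Fin d)) (Y : ℕ → Ω → ℝ) (P : ℝ → ℕ → Ω → ℝ)
    (n : ℕ) (ω : Ω) : Set ℝ :=
  argminIcc a b fun k => minOver (paramSpace c U k) (empiricalRisk m X Y n ω) + P k n ω

/-- The PanIC estimator: the smallest such minimizer. -/
def panICEstimator {d : ℕ} {Ω : Type*} (m : Regression) (c : Constraint) (U : Set ℝ) (a b : ℝ)
    (X : ℕ → Ω → EuclideanSpace ℝ (Fin d)) (Y : ℕ → Ω → ℝ) (P : ℝ → ℕ → Ω → ℝ)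
    (n : ℕ) (ω : Ω) : ℝ :=
  sInf (panICIndices m c U a b X Y P n ω)

/-- Divergence to `+∞` in probability. -/
def TendstoInProbabilityAtTop {Ω : Type*} [MeasurableSpace Ω] (μ : Measure Ω)
    (Z : ℕ → Ω → ℝ) : Prop :=
  ∀ M : ℝ, Tendsto (fun n => μ {ω | Z n ω ≤ M}) atTop (𝓝 0)

/-- The conditions on the penalty `P_{k,n}`, `k ∈ [a, b]`, `n ≥ 1`: it is random, positive,
`o_P(1)`, its increments in `k` diverge in probability after multiplication by `√n`, and it is
continuous and strictly increasing in `k`. -/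
structure IsPenalty {Ω : Type*} [MeasurableSpace Ω] (μ : Measure Ω) (a b : ℝ)
    (P : ℝ → ℕ → Ω → ℝ) : Prop where
  measurable : ∀ k ∈ Set.Icc a b, ∀ n : ℕ, 1 ≤ n → Measurable (P k n)
  pos : ∀ k ∈ Set.Icc a b, ∀ n : ℕ, 1 ≤ n → ∀ᵐ ω ∂μ, 0 < P k n ω
  tendsto_zero : ∀ k ∈ Set.Icc a b, TendstoInMeasure μ (fun n => P k n) atTop (fun _ => 0)
  increments : ∀ k ∈ Set.Icc a b, ∀ l ∈ Set.Icc a b, k < l →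
    TendstoInProbabilityAtTop μ (fun n ω => Real.sqrt n * (P l n ω - P k n ω))
  continuous_strictMono : ∀ n : ℕ, 1 ≤ n → ∀ᵐ ω ∂μ,
    ContinuousOn (fun k => P k n ω) (Set.Icc a b) ∧
      StrictMonoOn (fun k => P k n ω) (Set.Icc a b)

end PanIC

end

/-! The argument is a one-sided uniform deviation bound of order `n^{-1/2}`, followed by a
deterministic comparison of the penalized criterion at `k` and at `k* = k₀`.

Deviation bound. On a bounded parameter set the loss is Lipschitz in the linear predictor, with a
constant depending on the data. Hence the increments of the loss are dominated by those of linear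
forms `⟨θ, v⟩`, where `v` is a feature vector in `ℝ^{1+d}`, and the moment conditions give `E‖v‖² <
∞`. For a finite set of parameters of norm at most `C`, consider `w ↦ E max_i (⟨θ_i, w⟩ + ∑_k (E f_i
- f_i(Z_k)))`. With no observations it is at most `C‖w‖`, hence at most a quadratic in `‖w‖`.
Symmetrization and contraction turn one new observation into the average over the shifts `w ± 2v`,
and by the parallelogram law this preserves the leading coefficient of the quadratic and adds a
multiple of `E‖v‖²` to its constant term (`integral_prod_finMax_le`). After `n` observations, with
the free scale chosen as `√n`, the expected maximum at `w = 0` is `O(√n)`. Markov's inequality and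
separability give `measure_exists_lt_le`, with no chaining or entropy estimate.

Comparison. Let `θ₀` minimize the risk at `k₀`. Up to `η = M/√n`, the empirical excess risk over
`θ₀` is at least the true one. If `k ≤ k₀ - ε`, the true excess is at least some `δ > 0`, because
`k₀` is the smallest optimal index; a vanishing penalty at `k₀` cannot offset this. If `k ≥ k₀ + ε`,
the true excess is still nonnegative, so the empirical gain is at most `M/√n`, while the extra
penalty exceeds `M/√n` with high probability. This is `abs_sub_lt_of_mem_argminIcc`; monotonicity in
`k` reduces the penalty to its values at `a`, `k₀` and `k₀ + ε`.

Existence of smallest minimizers follows from lower semicontinuity in `k` of the constrained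
minimum. -/

namespace PanIC

/-! ### Maxima of finite families -/

section FiniteMax

variable {ι : Type*} [Fintype ι] [Nonempty ι]

/-- The maximum of a finite family of real numbers. -/
noncomputable def finMax (s : ι → ℝ) : ℝ := Finset.univ.sup' Finset.univ_nonempty s

lemma le_finMax (s : ι → ℝ) (i : ι) : s i ≤ finMax s :=
  Finset.le_sup' s (Finset.mem_univ i)

lemma exists_eq_finMax (s : ι → ℝ) : ∃ i, finMax s = s i := by
  obtain ⟨i, -, hi⟩ := Finset.exists_mem_eq_sup' (Finset.univ_nonempty (α := ι)) s
  exact ⟨i, hi⟩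

lemma continuous_finMax : Continuous (finMax : (ι → ℝ) → ℝ) :=
  Continuous.finset_sup'_apply Finset.univ_nonempty fun i _ => continuous_apply i

lemma abs_finMax_le (s : ι → ℝ) : |finMax s| ≤ ∑ i, |s i| := by
  obtain ⟨i, hi⟩ := exists_eq_finMax s
  rw [hi]
  exact Finset.single_le_sum (f := fun i => |s i|) (fun _ _ => abs_nonneg _) (Finset.mem_univ i)

lemma integrable_finMax {Ω : Type*} [MeasurableSpace Ω] {μ : Measure Ω} {s : Ω → ι → ℝ}
    (hs : ∀ i, Integrable (fun ω => s ω i) μ) : Integrable (fun ω => finMax (s ω)) μ := by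
  refine (integrable_finsetSum Finset.univ fun i _ => (hs i).abs).mono' ?_
    (Eventually.of_forall fun ω => by simpa using abs_finMax_le (s ω))
  exact continuous_finMax.comp_aestronglyMeasurable
    (aemeasurable_pi_lambda _ fun i => (hs i).aemeasurable).aestronglyMeasurable

end FiniteMax

/-! ### Symmetrization, contraction and the quadratic bound -/

section Contraction

variable {ι : Type*} [Fintype ι] [Nonempty ι] {S : Type*} [MeasurableSpace S] {ρ : Measure S}
  {E : Type*} [NormedAddCommGroup E] [InnerProductSpace ℝ E]

/-- Symmetrization and contraction for one observation. -/
lemma integral_finMax_centered_le [IsProbabilityMeasure ρ] {f : ι → S → ℝ}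
    (hf : ∀ i, Integrable (f i) ρ) {θ : ι → E} {v : S → E}
    (hv : ∀ i, Integrable (fun z => inner ℝ (θ i) (v z)) ρ)
    (hfv : ∀ i j z, |f i z - f j z| ≤ |inner ℝ (θ i - θ j) (v z)|) (A : ι → ℝ) :
    ∫ z, finMax (fun i => A i + (∫ z', f i z' ∂ρ - f i z)) ∂ρ ≤
      ∫ z, (finMax (fun i => A i + 2 * inner ℝ (θ i) (v z)) +
        finMax (fun i => A i - 2 * inner ℝ (θ i) (v z))) / 2 ∂ρ := by
  have i1 : Integrable (fun z => finMax (fun i => A i + 2 * f i z)) ρ :=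
    integrable_finMax fun i => (integrable_const _).add ((hf i).const_mul 2)
  have i2 : Integrable (fun z => finMax (fun i => A i - 2 * f i z)) ρ :=
    integrable_finMax fun i => (integrable_const _).sub ((hf i).const_mul 2)
  have i3 : Integrable (fun z => finMax (fun i => A i + 2 * inner ℝ (θ i) (v z))) ρ :=
    integrable_finMax fun i => (integrable_const _).add ((hv i).const_mul 2)
  have i4 : Integrable (fun z => finMax (fun i => A i - 2 * inner ℝ (θ i) (v z))) ρ :=
    integrable_finMax fun i => (integrable_const _).sub ((hv i).const_mul 2)
  have i5 : Integrable (fun z => finMax (fun i => A i + (∫ z', f i z' ∂ρ - f i z))) ρ :=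
    integrable_finMax fun i => (integrable_const _).add ((integrable_const _).sub (hf i))
  -- At a maximizing `i` the value is the midpoint of `A i + 2 E f i` and `A i - 2 f i z`; bounding
  -- each by its own maximum separates the two copies of the observation.
  have hpt : ∀ z, finMax (fun i => A i + (∫ z', f i z' ∂ρ - f i z)) ≤
      (∫ z', finMax (fun i => A i + 2 * f i z') ∂ρ + finMax (fun i => A i - 2 * f i z)) / 2 := by
    intro z
    obtain ⟨i, hi⟩ := exists_eq_finMax (fun i => A i + (∫ z', f i z' ∂ρ - f i z))
    have h1 : A i + 2 * ∫ z', f i z' ∂ρ ≤ ∫ z', finMax (fun i => A i + 2 * f i z') ∂ρ := by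
      have : A i + 2 * ∫ z', f i z' ∂ρ = ∫ z', (A i + 2 * f i z') ∂ρ := by
        rw [integral_add (integrable_const _) ((hf i).const_mul 2), integral_const_mul]
        simp
      rw [this]
      exact integral_mono ((integrable_const _).add ((hf i).const_mul 2)) i1
        fun z' => le_finMax (fun i => A i + 2 * f i z') i
    have h2 := le_finMax (fun i => A i - 2 * f i z) i
    rw [hi]
    linarith
  calc ∫ z, finMax (fun i => A i + (∫ z', f i z' ∂ρ - f i z)) ∂ρ
      ≤ ∫ z, (∫ z', finMax (fun i => A i + 2 * f i z') ∂ρ +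
          finMax (fun i => A i - 2 * f i z)) / 2 ∂ρ :=
        integral_mono i5 (((integrable_const _).add i2).div_const 2) hpt
    _ = ∫ z, (finMax (fun i => A i + 2 * f i z) + finMax (fun i => A i - 2 * f i z)) / 2 ∂ρ := by
        rw [integral_div, integral_div, integral_add (integrable_const _) i2, integral_add i1 i2]
        simp
    _ ≤ _ := by
        refine integral_mono ((i1.add i2).div_const 2) ((i3.add i4).div_const 2) fun z => ?_
        obtain ⟨i, hi⟩ := exists_eq_finMax (fun i => A i + 2 * f i z)
        obtain ⟨j, hj⟩ := exists_eq_finMax (fun i => A i - 2 * f i z)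
        have h := hfv i j z
        rw [inner_sub_left] at h
        have a1 := le_finMax (fun i => A i + 2 * inner ℝ (θ i) (v z)) i
        have a2 := le_finMax (fun i => A i + 2 * inner ℝ (θ i) (v z)) j
        have a3 := le_finMax (fun i => A i - 2 * inner ℝ (θ i) (v z)) i
        have a4 := le_finMax (fun i => A i - 2 * inner ℝ (θ i) (v z)) j
        simp only at a1 a2 a3 a4 ⊢
        rw [hi, hj]
        -- The absolute value is removed by choosing which of the two maximizers `i`, `j` is the
        -- competitor in the `+` maximum and which in the `-` maximum.
        have h' := le_of_abs_le h
        rcases le_total 0 (inner ℝ (θ i) (v z) - inner ℝ (θ j) (v z)) with h0 | h0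
        · rw [abs_of_nonneg h0] at h'; linarith
        · rw [abs_of_nonpos h0] at h'; linarith

/-- Adding one independent observation increases the quadratic bound by its second moment. -/
lemma integral_prod_finMax_le [IsProbabilityMeasure ρ] {f : ι → S → ℝ}
    (hf : ∀ i, Integrable (f i) ρ) {θ : ι → E} {v : S → E}
    (hvm : AEStronglyMeasurable v ρ) (hv2 : Integrable (fun z => ‖v z‖ ^ 2) ρ)
    (hfv : ∀ i j z, |f i z - f j z| ≤ |inner ℝ (θ i - θ j) (v z)|)
    {σ : Measure (ι → ℝ)} [IsProbabilityMeasure σ] (hσ : ∀ i, Integrable (fun s => s i) σ)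
    {p q r : ℝ}
    (hq : ∀ w, ∫ s, finMax (fun i => inner ℝ (θ i) w + s i) ∂σ ≤ p * ‖w‖ ^ 2 + q * r) (w : E) :
    ∫ x, finMax (fun i => inner ℝ (θ i) w + (x.1 i + (∫ z, f i z ∂ρ - f i x.2))) ∂(σ.prod ρ) ≤
      p * ‖w‖ ^ 2 + (q * r + 4 * p * ∫ z, ‖v z‖ ^ 2 ∂ρ) := by
  have hv1 : Integrable v ρ :=
    ((memLp_two_iff_integrable_sq_norm hvm).2 hv2).integrable one_le_two
  have hv : ∀ i, Integrable (fun z => inner ℝ (θ i) (v z)) ρ := fun i => hv1.const_inner (θ i)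
  have hσ1 : ∀ i, Integrable (fun x : (ι → ℝ) × S => x.1 i) (σ.prod ρ) :=
    fun i => (hσ i).comp_fst ρ
  have hf2 : ∀ i, Integrable (fun x : (ι → ℝ) × S => f i x.2) (σ.prod ρ) :=
    fun i => (hf i).comp_snd σ
  have hv2' : ∀ i, Integrable (fun x : (ι → ℝ) × S => inner ℝ (θ i) (v x.2)) (σ.prod ρ) :=
    fun i => (hv i).comp_snd σ
  have j0 : Integrable (fun x : (ι → ℝ) × S =>
      finMax (fun i => inner ℝ (θ i) w + (x.1 i + (∫ z, f i z ∂ρ - f i x.2)))) (σ.prod ρ) :=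
    integrable_finMax fun i => (integrable_const _).add
      ((hσ1 i).add ((integrable_const _).sub (hf2 i)))
  have j1 : Integrable (fun x : (ι → ℝ) × S =>
      finMax (fun i => inner ℝ (θ i) w + x.1 i + 2 * inner ℝ (θ i) (v x.2))) (σ.prod ρ) :=
    integrable_finMax fun i => ((integrable_const _).add (hσ1 i)).add ((hv2' i).const_mul 2)
  have j2 : Integrable (fun x : (ι → ℝ) × S =>
      finMax (fun i => inner ℝ (θ i) w + x.1 i - 2 * inner ℝ (θ i) (v x.2))) (σ.prod ρ) :=
    integrable_finMax fun i => ((integrable_const _).add (hσ1 i)).sub ((hv2' i).const_mul 2)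
  have j3 := (j1.add j2).div_const 2
  have k1 : Integrable (fun z => p * ‖w + (2 : ℝ) • v z‖ ^ 2) ρ :=
    (((memLp_two_iff_integrable_sq_norm (by fun_prop)).1
      ((memLp_const w).add (((memLp_two_iff_integrable_sq_norm hvm).2 hv2).const_smul
        (2 : ℝ))))).const_mul p
  have k2 : Integrable (fun z => p * ‖w - (2 : ℝ) • v z‖ ^ 2) ρ :=
    (((memLp_two_iff_integrable_sq_norm (by fun_prop)).1
      ((memLp_const w).sub (((memLp_two_iff_integrable_sq_norm hvm).2 hv2).const_smul
        (2 : ℝ))))).const_mul p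
  calc _ = ∫ s, ∫ z, finMax (fun i => inner ℝ (θ i) w + (s i + (∫ z, f i z ∂ρ - f i z))) ∂ρ ∂σ :=
        integral_prod _ j0
    _ ≤ ∫ s, ∫ z, (finMax (fun i => inner ℝ (θ i) w + s i + 2 * inner ℝ (θ i) (v z)) +
        finMax (fun i => inner ℝ (θ i) w + s i - 2 * inner ℝ (θ i) (v z))) / 2 ∂ρ ∂σ := by
        refine integral_mono j0.integral_prod_left j3.integral_prod_left fun s => ?_
        have := integral_finMax_centered_le hf hv hfv (fun i => inner ℝ (θ i) w + s i)
        simpa only [add_assoc] using this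
    _ = ∫ z, ∫ s, (finMax (fun i => inner ℝ (θ i) w + s i + 2 * inner ℝ (θ i) (v z)) +
        finMax (fun i => inner ℝ (θ i) w + s i - 2 * inner ℝ (θ i) (v z))) / 2 ∂σ ∂ρ :=
        integral_integral_swap j3
    _ ≤ ∫ z, ((p * ‖w + (2 : ℝ) • v z‖ ^ 2 + q * r) +
          (p * ‖w - (2 : ℝ) • v z‖ ^ 2 + q * r)) / 2 ∂ρ := by
        refine integral_mono j3.integral_prod_right
          (((k1.add (integrable_const _)).add (k2.add (integrable_const _))).div_const 2)
          fun z => ?_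
        simp only
        have l1 : Integrable (fun s : ι → ℝ =>
            finMax (fun i => inner ℝ (θ i) w + s i + 2 * inner ℝ (θ i) (v z))) σ :=
          integrable_finMax fun i => ((integrable_const _).add (hσ i)).add (integrable_const _)
        have l2 : Integrable (fun s : ι → ℝ =>
            finMax (fun i => inner ℝ (θ i) w + s i - 2 * inner ℝ (θ i) (v z))) σ :=
          integrable_finMax fun i => ((integrable_const _).add (hσ i)).sub (integrable_const _)
        rw [integral_div, integral_add l1 l2]
        -- The terms `± 2⟨θ i, v z⟩` are absorbed into the argument `w`, which is why the bound is
        -- assumed for every `w`.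
        have h1 := hq (w + (2 : ℝ) • v z)
        have h2 := hq (w - (2 : ℝ) • v z)
        simp only [inner_add_right, inner_sub_right, inner_smul_right] at h1 h2
        have e1 : ∀ s : ι → ℝ, (fun i => inner ℝ (θ i) w + s i + 2 * inner ℝ (θ i) (v z)) =
          fun i => inner ℝ (θ i) w + 2 * inner ℝ (θ i) (v z) + s i := fun s => by
            funext i; ring
        have e2 : ∀ s : ι → ℝ, (fun i => inner ℝ (θ i) w + s i - 2 * inner ℝ (θ i) (v z)) =
          fun i => inner ℝ (θ i) w - 2 * inner ℝ (θ i) (v z) + s i := fun s => by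
            funext i; ring
        simp only [e1, e2]
        linarith
    _ = ∫ z, (p * ‖w‖ ^ 2 + q * r + 4 * p * ‖v z‖ ^ 2) ∂ρ := by
        refine integral_congr_ae (Eventually.of_forall fun z => ?_)
        have h := parallelogram_law_with_norm ℝ w ((2 : ℝ) • v z)
        rw [norm_smul] at h
        simp only [Real.norm_ofNat] at h
        have : ‖w + (2 : ℝ) • v z‖ ^ 2 + ‖w - (2 : ℝ) • v z‖ ^ 2 =
          2 * ‖w‖ ^ 2 + 8 * ‖v z‖ ^ 2 := by nlinarith
        linear_combination p / 2 * this
    _ = _ := by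
        rw [integral_add (integrable_const _) (hv2.const_mul _), integral_const_mul]
        simp
        ring

variable {Ω : Type*} [MeasurableSpace Ω] {μ : Measure Ω} [IsProbabilityMeasure μ]

/-- The maximal inequality for a finite class of functions that are dominated by linear forms. -/
lemma integral_finMax_sum_le {Z : ℕ → Ω → S} (hZ : ∀ k, Measurable (Z k))
    (hind : iIndepFun Z μ) (hlaw : ∀ k, μ.map (Z k) = ρ) {f : ι → S → ℝ}
    (hfm : ∀ i, Measurable (f i)) (hf : ∀ i, Integrable (f i) ρ) {θ : ι → E} {v : S → E}
    (hvm : AEStronglyMeasurable v ρ) (hv2 : Integrable (fun z => ‖v z‖ ^ 2) ρ)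
    (hfv : ∀ i j z, |f i z - f j z| ≤ |inner ℝ (θ i - θ j) (v z)|)
    {C : ℝ} (hθ : ∀ i, ‖θ i‖ ≤ C) {t : ℝ} (ht : 0 < t) (n : ℕ) (w : E) :
    ∫ ω, finMax (fun i => inner ℝ (θ i) w +
        ∑ k ∈ Finset.range n, (∫ z, f i z ∂ρ - f i (Z k ω))) ∂μ ≤
      C / (2 * t) * ‖w‖ ^ 2 +
        1 * (C * t / 2 + 4 * (C / (2 * t)) * (n * ∫ z, ‖v z‖ ^ 2 ∂ρ)) := by
  have : IsProbabilityMeasure ρ := hlaw 0 ▸ Measure.isProbabilityMeasure_map (hZ 0).aemeasurable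
  induction n generalizing w with
  | zero =>
    simp only [Finset.range_zero, Finset.sum_empty, add_zero, integral_const, probReal_univ,
      smul_eq_mul, one_mul, Nat.cast_zero, zero_mul, mul_zero]
    obtain ⟨i, hi⟩ := exists_eq_finMax (fun i => (inner ℝ (θ i) w : ℝ))
    have hC : 0 ≤ C := (norm_nonneg _).trans (hθ i)
    rw [hi]
    have h1 : inner ℝ (θ i) w ≤ C * ‖w‖ :=
      (real_inner_le_norm _ _).trans (mul_le_mul_of_nonneg_right (hθ i) (norm_nonneg _))
    -- Replaces the linear bound `C‖w‖` by a quadratic one, the only shape that the parallelogram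
    -- law carries through the induction.
    have h2 : C / (2 * t) * ‖w‖ ^ 2 + C * t / 2 - C * ‖w‖ = C / (2 * t) * (‖w‖ - t) ^ 2 := by
      field_simp; ring
    have h3 : 0 ≤ C / (2 * t) * (‖w‖ - t) ^ 2 := by positivity
    linarith
  | succ n ih =>
    set T : Ω → ι → ℝ := fun ω i => ∑ k ∈ Finset.range n, (∫ z, f i z ∂ρ - f i (Z k ω)) with hT
    have hTm : Measurable T := measurable_pi_lambda _ fun i =>
      Finset.measurable_fun_sum _ fun k _ => measurable_const.sub ((hfm i).comp (hZ k))
    have hTi : ∀ i, Integrable (fun ω => T ω i) μ := fun i =>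
      integrable_finsetSum _ fun k _ => (integrable_const _).sub
        (((hlaw k).symm ▸ hf i).comp_measurable (hZ k))
    have : IsProbabilityMeasure (μ.map T) := Measure.isProbabilityMeasure_map hTm.aemeasurable
    have hindT : IndepFun T (Z n) μ := by
      have h := hind.indepFun_finset (Finset.range n) {n} (by simp) hZ
      refine h.comp (φ := fun (y : Finset.range n → S) (i : ι) =>
        ∑ k, (∫ z, f i z ∂ρ - f i (y k))) (ψ := fun y => y ⟨n, by simp⟩) ?_ ?_ |>.congr ?_ ?_
      · exact measurable_pi_lambda _ fun i => Finset.measurable_fun_sum _ fun k _ =>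
          measurable_const.sub ((hfm i).comp (measurable_pi_apply k))
      · exact measurable_pi_apply _
      · refine Eventually.of_forall fun ω => ?_
        funext i
        simp only [hT, Function.comp]
        exact Finset.sum_coe_sort (Finset.range n) (fun k => ∫ z, f i z ∂ρ - f i (Z k ω))
      · exact Eventually.of_forall fun ω => rfl
    have hprod : μ.map (fun ω => (T ω, Z n ω)) = (μ.map T).prod ρ := by
      rw [(indepFun_iff_map_prod_eq_prod_map_map hTm.aemeasurable (hZ n).aemeasurable).1 hindT,
        hlaw n]
    have hσ : ∀ i, Integrable (fun s : ι → ℝ => s i) (μ.map T) := fun i =>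
      (integrable_map_measure (measurable_pi_apply i).aestronglyMeasurable hTm.aemeasurable).2 (hTi i)
    have hstep := integral_prod_finMax_le hf hvm hv2 hfv (σ := μ.map T) hσ
      (p := C / (2 * t)) (q := 1) (fun w => by
        rw [integral_map hTm.aemeasurable]
        · exact ih w
        · exact (continuous_finMax.comp (by fun_prop)).aestronglyMeasurable) w
    rw [← hprod, integral_map (hTm.prodMk (hZ n)).aemeasurable] at hstep
    · simp only [Finset.sum_range_succ]
      refine hstep.trans (le_of_eq ?_)
      push_cast
      ring
    · refine (continuous_finMax.measurable.comp (measurable_pi_lambda _ fun i => ?_)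
        ).aestronglyMeasurable
      exact measurable_const.add (((measurable_pi_apply i).comp measurable_fst).add
        (measurable_const.sub ((hfm i).comp measurable_snd)))

end Contraction

end PanIC

namespace PanIC

/-! ### Maximal inequalities in probability -/

section MaximalInequality

variable {S : Type*} [MeasurableSpace S] {ρ : Measure S}
  {E : Type*} [NormedAddCommGroup E] [InnerProductSpace ℝ E]
  {Ω : Type*} [MeasurableSpace Ω] {μ : Measure Ω} [IsProbabilityMeasure μ]

/-- Subtracting the sum at `i₀` makes the maximum nonnegative, so Markov's inequality applies; since
that sum has mean zero, the expectation is unchanged. -/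
lemma measure_finMax_sub_ge_le {ι : Type*} [Fintype ι] [Nonempty ι] (i₀ : ι)
    {Z : ℕ → Ω → S} (hZ : ∀ k, Measurable (Z k))
    (hind : iIndepFun Z μ) (hlaw : ∀ k, μ.map (Z k) = ρ) {f : ι → S → ℝ}
    (hfm : ∀ i, Measurable (f i)) (hf : ∀ i, Integrable (f i) ρ) {θ : ι → E} {v : S → E}
    (hvm : AEStronglyMeasurable v ρ) (hv2 : Integrable (fun z => ‖v z‖ ^ 2) ρ)
    (hfv : ∀ i j z, |f i z - f j z| ≤ |inner ℝ (θ i - θ j) (v z)|)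
    {C : ℝ} (hθ : ∀ i, ‖θ i‖ ≤ C) {n : ℕ} (hn : 1 ≤ n) {M : ℝ} (hM : 0 < M) :
    μ {ω | M * √n ≤ finMax (fun i => ∑ k ∈ Finset.range n, (∫ z, f i z ∂ρ - f i (Z k ω))) -
        ∑ k ∈ Finset.range n, (∫ z, f i₀ z ∂ρ - f i₀ (Z k ω))} ≤
      ENNReal.ofReal ((C / 2 + 2 * C * ∫ z, ‖v z‖ ^ 2 ∂ρ) / M) := by
  have hn' : 0 < √(n : ℝ) := Real.sqrt_pos.2 (by exact_mod_cast hn)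
  have hfZ : ∀ i k, Integrable (fun ω => f i (Z k ω)) μ := fun i k =>
    ((hlaw k).symm ▸ hf i).comp_measurable (hZ k)
  have hTi : ∀ i, Integrable
      (fun ω => ∑ k ∈ Finset.range n, (∫ z, f i z ∂ρ - f i (Z k ω))) μ := fun i =>
    integrable_finsetSum _ fun k _ => (integrable_const _).sub (hfZ i k)
  have hmean : ∫ ω, ∑ k ∈ Finset.range n, (∫ z, f i₀ z ∂ρ - f i₀ (Z k ω)) ∂μ = 0 := by
    rw [integral_finsetSum (f := fun k ω => ∫ z, f i₀ z ∂ρ - f i₀ (Z k ω)) _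
      fun k _ => (integrable_const _).sub (hfZ i₀ k)]
    refine Finset.sum_eq_zero fun k _ => ?_
    rw [integral_sub (integrable_const _) (hfZ i₀ k), ← hlaw k,
      integral_map (hZ k).aemeasurable (hfm i₀).aestronglyMeasurable]
    simp
  -- The scale `t = √n` balances `C t / 2` against `2 C n E‖v‖² / t`.
  have hmax := integral_finMax_sum_le hZ hind hlaw hfm hf hvm hv2 hfv hθ hn' n 0
  simp only [inner_zero_right, zero_add, norm_zero] at hmax
  have hint := (integrable_finMax hTi).sub (hTi i₀)
  have hmarkov := mul_meas_ge_le_integral_of_nonneg (μ := μ)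
    (Eventually.of_forall fun ω => sub_nonneg.2 (le_finMax (fun i =>
      ∑ k ∈ Finset.range n, (∫ z, f i z ∂ρ - f i (Z k ω))) i₀)) hint (M * √n)
  rw [integral_sub (integrable_finMax hTi) (hTi i₀), hmean, sub_zero] at hmarkov
  have hsq : √(n : ℝ) ^ 2 = n := Real.sq_sqrt (Nat.cast_nonneg n)
  have hval : ∀ K q : ℝ, 0 < q → C / (2 * q) * 0 ^ 2 + 1 * (C * q / 2 +
      4 * (C / (2 * q)) * (q ^ 2 * K)) = (C / 2 + 2 * C * K) * q := by
    intro K q hq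
    field_simp
    ring
  nth_rewrite 4 [← hsq] at hmax
  rw [hval _ _ hn'] at hmax
  rw [← ofReal_measureReal]
  refine ENNReal.ofReal_le_ofReal ((le_div_iff₀ hM).2 ?_)
  have h := hmarkov.trans hmax
  rw [mul_right_comm] at h
  rw [mul_comm]
  exact le_of_mul_le_mul_right h hn'

/-- The maximal inequality for a continuously parametrized class of functions. -/
lemma measure_exists_lt_le {Θ : Type*} [TopologicalSpace Θ] [SecondCountableTopology Θ]
    {T : Set Θ} {θ₀ : Θ} (hθ₀ : θ₀ ∈ T) {Z : ℕ → Ω → S} (hZ : ∀ k, Measurable (Z k))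
    (hind : iIndepFun Z μ) (hlaw : ∀ k, μ.map (Z k) = ρ) {f : Θ → S → ℝ}
    (hfm : ∀ θ, Measurable (f θ)) (hf : ∀ θ, Integrable (f θ) ρ)
    (hfc : ∀ z, Continuous fun θ => f θ z) (hrc : Continuous fun θ => ∫ z, f θ z ∂ρ)
    {φ : Θ → E} {v : S → E}
    (hvm : AEStronglyMeasurable v ρ) (hv2 : Integrable (fun z => ‖v z‖ ^ 2) ρ)
    (hfv : ∀ θ ∈ T, ∀ θ' ∈ T, ∀ z, |f θ z - f θ' z| ≤ |inner ℝ (φ θ - φ θ') (v z)|)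
    {C : ℝ} (hφ : ∀ θ ∈ T, ‖φ θ‖ ≤ C) {n : ℕ} (hn : 1 ≤ n) {M : ℝ} (hM : 0 < M) :
    μ {ω | ∃ θ ∈ T, M * √n < ∑ k ∈ Finset.range n, (∫ z, f θ z ∂ρ - f θ (Z k ω)) -
        ∑ k ∈ Finset.range n, (∫ z, f θ₀ z ∂ρ - f θ₀ (Z k ω))} ≤
      ENNReal.ofReal ((C / 2 + 2 * C * ∫ z, ‖v z‖ ^ 2 ∂ρ) / M) := by
  have : Nonempty T := ⟨⟨θ₀, hθ₀⟩⟩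
  set u := TopologicalSpace.denseSeq T with hu
  set D : Θ → Ω → ℝ := fun θ ω => ∑ k ∈ Finset.range n, (∫ z, f θ z ∂ρ - f θ (Z k ω)) with hD
  have hDc : ∀ ω, Continuous fun θ => D θ ω := fun ω =>
    continuous_finsetSum _ fun k _ => hrc.sub (hfc (Z k ω))
  -- The strict inequality is an open condition on `θ`, so it already holds at a point of the dense
  -- sequence.
  have hsub : {ω | ∃ θ ∈ T, M * √n < D θ ω - D θ₀ ω} ⊆
      ⋃ N : ℕ, {ω | ∃ j ≤ N, M * √n < D (u j) ω - D θ₀ ω} := by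
    rintro ω ⟨θ, hθ, h⟩
    have hopen : IsOpen {x : T | M * √n < D x ω - D θ₀ ω} :=
      isOpen_lt continuous_const (((hDc ω).comp continuous_subtype_val).sub continuous_const)
    obtain ⟨x, hx, j, rfl⟩ := (TopologicalSpace.denseRange_denseSeq T).inter_open_nonempty _ hopen
      ⟨⟨θ, hθ⟩, h⟩
    exact Set.mem_iUnion.2 ⟨j, j, le_rfl, hx⟩
  refine (measure_mono hsub).trans ?_
  rw [Monotone.measure_iUnion]
  · refine iSup_le fun N => ?_
    -- The index `none` is the base point `θ₀`. The bound does not depend on `N`, so it survives the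
    -- increasing union.
    let e : Option (Fin (N + 1)) → T := fun o => o.elim ⟨θ₀, hθ₀⟩ fun j => u j
    refine (measure_mono ?_).trans (measure_finMax_sub_ge_le (ι := Option (Fin (N + 1))) none hZ
      hind hlaw (f := fun o => f (e o)) (fun o => hfm _) (fun o => hf _)
      (θ := fun o => φ (e o)) hvm hv2
      (fun i j z => hfv _ (e i).2 _ (e j).2 z) (fun i => hφ _ (e i).2) hn hM)
    rintro ω ⟨j, hj, h⟩
    exact h.le.trans (sub_le_sub_right (le_finMax (fun o => D (e o) ω)
      (some ⟨j, Nat.lt_succ_of_le hj⟩)) _)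
  · rintro N N' h ω ⟨j, hj, h'⟩
    exact ⟨j, hj.trans h, h'⟩

end MaximalInequality

/-! ### Constrained minima and smallest minimizers -/

lemma minOver_eq {S : Type*} {T : Set S} {f : S → ℝ} {θ : S} (hθ : θ ∈ T) (h : IsMinOn f T θ) :
    minOver T f = f θ :=
  IsLeast.csInf_eq ⟨Set.mem_image_of_mem f hθ, by
    rintro _ ⟨x, hx, rfl⟩; exact h hx⟩

section Minima

variable {S : Type*} [TopologicalSpace S]

/-- Minima over the sublevel sets of a constraint on a set that need not be compact itself. -/
lemma exists_isMinOn_sublevel {W : Set S} {g f : S → ℝ} {k : ℝ}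
    (hcomp : IsCompact {θ | θ ∈ W ∧ g θ ≤ k}) (hne : {θ | θ ∈ W ∧ g θ ≤ k}.Nonempty)
    (hf : Continuous f) :
    ∃ θ ∈ {θ | θ ∈ W ∧ g θ ≤ k}, IsMinOn f {θ | θ ∈ W ∧ g θ ≤ k} θ :=
  hcomp.exists_isMinOn hne hf.continuousOn

lemma minOver_le {T : Set S} {f : S → ℝ} (hT : IsCompact T) (hf : Continuous f) {θ : S}
    (hθ : θ ∈ T) : minOver T f ≤ f θ :=
  csInf_le (hT.image hf).bddBelow (Set.mem_image_of_mem f hθ)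

/-- For a level `y`, let `g*` be the least value of the constraint on the compact set `f ≤ y` inside
the largest parameter set. The minimum at `k` exceeds `y` exactly when `k < g*` (always, if that set
is empty), and this is an open condition on `k`. -/
lemma lowerSemicontinuousOn_minOver {W : Set S} {g f : S → ℝ} (hg : Continuous g)
    (hf : Continuous f) {a b : ℝ} (hcomp : ∀ k ∈ Set.Icc a b, IsCompact {θ | θ ∈ W ∧ g θ ≤ k})
    (hne : ∀ k ∈ Set.Icc a b, {θ | θ ∈ W ∧ g θ ≤ k}.Nonempty) :
    LowerSemicontinuousOn (fun k => minOver {θ | θ ∈ W ∧ g θ ≤ k} f) (Set.Icc a b) := by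
  intro k₀ hk₀ y hy
  have hab : a ≤ b := hk₀.1.trans hk₀.2
  set B : Set S := {θ | θ ∈ W ∧ g θ ≤ b} with hB
  have hBc : IsCompact (B ∩ {θ | f θ ≤ y}) :=
    (hcomp b ⟨hab, le_rfl⟩).inter_right (isClosed_le hf continuous_const)
  have hmin : ∀ k ∈ Set.Icc a b, minOver {θ | θ ∈ W ∧ g θ ≤ k} f ≤ y →
      ∃ θ ∈ B ∩ {θ | f θ ≤ y}, g θ ≤ k := by
    intro k hk hle
    obtain ⟨θ, hθ, h⟩ := exists_isMinOn_sublevel (hcomp k hk) (hne k hk) hf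
    rw [minOver_eq hθ h] at hle
    exact ⟨θ, ⟨⟨hθ.1, hθ.2.trans hk.2⟩, hle⟩, hθ.2⟩
  by_cases hBe : (B ∩ {θ | f θ ≤ y}).Nonempty
  · obtain ⟨θ, hθ, h⟩ := hBc.exists_isMinOn hBe hg.continuousOn
    have hlt : k₀ < g θ := by
      by_contra! hle
      exact absurd (minOver_le (hcomp k₀ hk₀) hf (θ := θ) ⟨hθ.1.1, hle⟩)
        (not_le.2 (hθ.2.trans_lt hy))
    filter_upwards [self_mem_nhdsWithin, mem_nhdsWithin_of_mem_nhds (Iio_mem_nhds hlt)] with k hk hk'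
    by_contra! hle
    obtain ⟨θ', hθ', h'⟩ := hmin k hk hle
    exact absurd ((h hθ').trans h') (not_le.2 hk')
  · filter_upwards [self_mem_nhdsWithin] with k hk
    by_contra! hle
    obtain ⟨θ', hθ', -⟩ := hmin k hk hle
    exact hBe ⟨θ', hθ'⟩

/-- The minimizers form the sublevel set at the minimal level, which is compact by lower
semicontinuity and so contains its infimum. -/
lemma isLeast_argminIcc {a b : ℝ} (hab : a ≤ b) {V : ℝ → ℝ}
    (hV : LowerSemicontinuousOn V (Set.Icc a b)) :
    IsLeast (argminIcc a b V) (sInf (argminIcc a b V)) := by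
  obtain ⟨k₀, hk₀, h₀⟩ := hV.exists_isMinOn (Set.nonempty_Icc.2 hab) isCompact_Icc
  refine IsCompact.isLeast_sInf ?_ ⟨k₀, hk₀, h₀⟩
  have heq : argminIcc a b V = Set.Icc a b ∩ V ⁻¹' Set.Iic (V k₀) := by
    ext k
    constructor
    · rintro ⟨hk, h⟩
      exact ⟨hk, h hk₀⟩
    · rintro ⟨hk, h⟩
      exact ⟨hk, fun x hx => (show V k ≤ V k₀ from h).trans (h₀ hx)⟩
  obtain ⟨F, hF, hFe⟩ := lowerSemicontinuousOn_iff_preimage_Iic.1 hV (V k₀)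
  rw [heq, hFe]
  exact isCompact_Icc.inter_right hF

end Minima

end PanIC

namespace PanIC

/-! ### Regularity of the losses and domination by linear forms -/

section Loss

/-- The loss as a function of the response and the linear predictor. -/
noncomputable def Regression.linkLoss (m : Regression) (y η : ℝ) : ℝ :=
  match m with
  | .linear => (y - η) ^ 2
  | .logistic => Real.log (1 + Real.exp η) - y * η
  | .poisson => Real.exp η - y * η + Real.log (Nat.factorial ⌊y⌋₊ : ℝ)
  | .gamma ν => (ν : ℝ) * η + y * (ν : ℝ) * Real.exp (-η) - ((ν : ℝ) - 1) * Real.log y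

/-- A Lipschitz constant of `linkLoss` for linear predictors in `[-t, t]`. -/
noncomputable def Regression.lipBound (m : Regression) (y t : ℝ) : ℝ :=
  match m with
  | .linear => 2 * (|y| + t)
  | .logistic => 1 + |y|
  | .poisson => |y| + Real.exp t
  | .gamma ν => (ν : ℝ) * (1 + |y| * Real.exp t)

variable {d : ℕ}

lemma Regression.loss_eq_linkLoss (m : Regression) (x : EuclideanSpace ℝ (Fin d)) (y : ℝ)
    (θ : Param d) : m.loss x y θ = m.linkLoss y (linearPredictor θ x) := by
  cases m with
  | linear => rfl
  | logistic =>
    simp only [loss, lossAt, mean, linkLoss]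
    set η := linearPredictor θ x
    have h0 := Real.exp_pos η
    have h1 : (1 + Real.exp (-η))⁻¹ = Real.exp η / (1 + Real.exp η) := by
      rw [Real.exp_neg]; field_simp; ring
    have h2 : 1 - (1 + Real.exp (-η))⁻¹ = (1 + Real.exp η)⁻¹ := by
      rw [h1]; field_simp; ring
    rw [h2, h1, Real.log_div h0.ne' (by positivity), Real.log_inv, Real.log_exp]
    ring
  | poisson =>
    simp only [loss, lossAt, mean, linkLoss, Real.log_exp]
    ring
  | gamma ν =>
    simp only [loss, lossAt, mean, linkLoss, Real.log_exp, Real.exp_neg]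
    ring

lemma Regression.lipBound_nonneg (m : Regression) (y : ℝ) {t : ℝ} (ht : 0 ≤ t) :
    0 ≤ m.lipBound y t := by
  cases m with
  | gamma ν => have := ν.2; rw [Set.mem_Ioi] at this; simp only [lipBound]; positivity
  | _ => simp only [lipBound]; positivity

lemma Regression.abs_linkLoss_sub_le (m : Regression) (y : ℝ) {t η η' : ℝ}
    (hη : |η| ≤ t) (hη' : |η'| ≤ t) :
    |m.linkLoss y η - m.linkLoss y η'| ≤ m.lipBound y t * |η - η'| := by
  -- Mean value inequality on `[-t, t]`; each problem then only needs its derivative and a bound on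
  -- it.
  have key : ∀ f' : ℝ → ℝ, (∀ x, HasDerivAt (m.linkLoss y) (f' x) x) →
      (∀ x, |x| ≤ t → |f' x| ≤ m.lipBound y t) →
      |m.linkLoss y η - m.linkLoss y η'| ≤ m.lipBound y t * |η - η'| := by
    intro f' h1 h2
    exact (convex_Icc (-t) t).norm_image_sub_le_of_norm_hasDerivWithin_le
      (fun x _ => (h1 x).hasDerivWithinAt) (fun x hx => h2 x (abs_le.2 hx))
      (abs_le.1 hη') (abs_le.1 hη)
  cases m with
  | linear =>
    refine key (fun x => 2 * (y - x) * (-1)) (fun x => ?_) fun x hx => ?_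
    · have h : HasDerivAt (Regression.linear.linkLoss y) _ x :=
        ((hasDerivAt_id x).const_sub y).pow 2
      exact h.congr_deriv (by simp)
    · rw [abs_mul, abs_mul]
      simp only [lipBound, Nat.abs_ofNat, abs_neg, abs_one, mul_one]
      linarith [abs_sub y x]
  | logistic =>
    refine key (fun x => Real.exp x / (1 + Real.exp x) - y) (fun x => ?_) fun x hx => ?_
    · have h0 : (1 + Real.exp x) ≠ 0 := by positivity
      have h : HasDerivAt (Regression.logistic.linkLoss y) _ x :=
        (((Real.hasDerivAt_exp x).const_add 1).log h0).sub ((hasDerivAt_id x).const_mul y)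
      exact h.congr_deriv (by simp)
    · have h0 := Real.exp_pos x
      have h1 : |Real.exp x / (1 + Real.exp x)| ≤ 1 := by
        rw [abs_of_nonneg (by positivity), div_le_one (by positivity)]
        linarith
      simp only [lipBound]
      linarith [abs_sub (Real.exp x / (1 + Real.exp x)) y]
  | poisson =>
    refine key (fun x => Real.exp x - y) (fun x => ?_) fun x hx => ?_
    · have h : HasDerivAt (Regression.poisson.linkLoss y) _ x :=
        ((Real.hasDerivAt_exp x).sub ((hasDerivAt_id x).const_mul y)).add_const
          (Real.log (Nat.factorial ⌊y⌋₊ : ℝ))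
      exact h.congr_deriv (by simp)
    · have h1 : |Real.exp x| ≤ Real.exp t := by
        rw [Real.abs_exp]; exact Real.exp_le_exp.2 ((le_abs_self x).trans hx)
      simp only [lipBound]
      linarith [abs_sub (Real.exp x) y]
  | gamma ν =>
    have hν : (0 : ℝ) < ν := ν.2
    refine key (fun x => (ν : ℝ) - y * ν * Real.exp (-x)) (fun x => ?_) fun x hx => ?_
    · have h : HasDerivAt ((Regression.gamma ν).linkLoss y) _ x := (((hasDerivAt_id x).const_mul (ν : ℝ)).add
        (((hasDerivAt_neg x).exp).const_mul (y * (ν : ℝ)))).sub_const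
          (((ν : ℝ) - 1) * Real.log y)
      exact h.congr_deriv (by simp; ring)
    · have h1 : Real.exp (-x) ≤ Real.exp t := Real.exp_le_exp.2 ((neg_le_abs x).trans hx)
      have h2 := abs_sub (ν : ℝ) (y * ν * Real.exp (-x))
      rw [abs_mul, abs_mul, Real.abs_exp, abs_of_pos hν] at h2
      have h3 : |y| * ν * Real.exp (-x) ≤ |y| * ν * Real.exp t := by gcongr
      simp only [lipBound]
      linarith

lemma linearPredictor_eq_inner (θ : Param d) (x : EuclideanSpace ℝ (Fin d)) :
    linearPredictor θ x = inner ℝ (WithLp.toLp 2 θ) (WithLp.toLp 2 ((1 : ℝ), x)) := by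
  simp [linearPredictor, WithLp.prod_inner_apply, PiLp.inner_apply, mul_comm]

lemma continuous_linearPredictor :
    Continuous fun p : Param d × EuclideanSpace ℝ (Fin d) => linearPredictor p.1 p.2 := by
  unfold linearPredictor
  fun_prop

lemma abs_linearPredictor_le (θ : Param d) (x : EuclideanSpace ℝ (Fin d)) :
    |linearPredictor θ x| ≤ ‖θ‖ * (1 + ‖x‖) := by
  have h : linearPredictor θ x = θ.1 + inner ℝ θ.2 x := by
    simp [linearPredictor, PiLp.inner_apply, mul_comm]
  rw [h]
  have h1 : |θ.1| ≤ ‖θ‖ := norm_fst_le θ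
  have h2 : |inner ℝ θ.2 x| ≤ ‖θ‖ * ‖x‖ :=
    (abs_real_inner_le_norm _ _).trans (by gcongr; exact norm_snd_le θ)
  linarith [abs_add_le θ.1 (inner ℝ θ.2 x)]

/-- The vector that dominates the increments of the loss on the ball of radius `R`. -/
noncomputable def Regression.feature (m : Regression) (R : ℝ)
    (z : EuclideanSpace ℝ (Fin d) × ℝ) : WithLp 2 (ℝ × EuclideanSpace ℝ (Fin d)) :=
  m.lipBound z.2 (R * (1 + ‖z.1‖)) • WithLp.toLp 2 ((1 : ℝ), z.1)

lemma Regression.norm_feature_sq (m : Regression) (R : ℝ)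
    (z : EuclideanSpace ℝ (Fin d) × ℝ) :
    ‖m.feature R z‖ ^ 2 = m.lipBound z.2 (R * (1 + ‖z.1‖)) ^ 2 * (1 + ‖z.1‖ ^ 2) := by
  rw [feature, norm_smul, mul_pow, WithLp.prod_norm_sq_eq_of_L2]
  simp

lemma Regression.abs_loss_sub_le_inner (m : Regression) {R : ℝ} (hR : 0 ≤ R) {θ θ' : Param d}
    (hθ : ‖θ‖ ≤ R) (hθ' : ‖θ'‖ ≤ R) (z : EuclideanSpace ℝ (Fin d) × ℝ) :
    |m.loss z.1 z.2 θ - m.loss z.1 z.2 θ'| ≤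
      |inner ℝ (WithLp.toLp 2 θ - WithLp.toLp 2 θ') (m.feature R z)| := by
  have hb : ∀ θ : Param d, ‖θ‖ ≤ R → |linearPredictor θ z.1| ≤ R * (1 + ‖z.1‖) := fun θ h =>
    (abs_linearPredictor_le θ z.1).trans (by gcongr)
  rw [loss_eq_linkLoss, loss_eq_linkLoss, feature, inner_smul_right, inner_sub_left,
    ← linearPredictor_eq_inner, ← linearPredictor_eq_inner, abs_mul,
    abs_of_nonneg (m.lipBound_nonneg z.2 (by positivity))]
  exact m.abs_linkLoss_sub_le z.2 (hb θ hθ) (hb θ' hθ')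

/-- Compares with the zero predictor, so that integrability of the loss reduces to `linkLoss` at `0`
and to the squared feature norm. -/
lemma Regression.abs_loss_le (m : Regression) {R : ℝ} (hR : 0 ≤ R) {θ : Param d}
    (hθ : ‖θ‖ ≤ R) (z : EuclideanSpace ℝ (Fin d) × ℝ) :
    |m.loss z.1 z.2 θ| ≤ |m.linkLoss z.2 0| + R * (‖m.feature R z‖ ^ 2 + 1) := by
  have h0 : linearPredictor (0 : Param d) z.1 = 0 := by simp [linearPredictor]
  have hb : |linearPredictor θ z.1| ≤ R * (1 + ‖z.1‖) :=
    (abs_linearPredictor_le θ z.1).trans (by gcongr)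
  have hL := m.lipBound_nonneg z.2 (t := R * (1 + ‖z.1‖)) (by positivity)
  have h := m.abs_linkLoss_sub_le z.2 hb (η' := 0) (by rw [abs_zero]; positivity)
  rw [sub_zero] at h
  rw [loss_eq_linkLoss, norm_feature_sq]
  set L := m.lipBound z.2 (R * (1 + ‖z.1‖))
  have h1 : L * |linearPredictor θ z.1| ≤ L * (R * (1 + ‖z.1‖)) := by gcongr
  have h2 : L * (1 + ‖z.1‖) ≤ L ^ 2 * (1 + ‖z.1‖ ^ 2) + 1 := by
    nlinarith [sq_nonneg (L * (1 + ‖z.1‖) - 1), sq_nonneg (L * (1 - ‖z.1‖))]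
  have h3 := mul_le_mul_of_nonneg_left h2 hR
  have h4 := abs_sub_abs_le_abs_sub (m.linkLoss z.2 (linearPredictor θ z.1)) (m.linkLoss z.2 0)
  linarith

lemma Regression.continuous_linkLoss (m : Regression) (y : ℝ) : Continuous (m.linkLoss y) := by
  change Continuous fun η => m.linkLoss y η
  cases m with
  | logistic =>
    simp only [linkLoss]
    exact (Continuous.log (by fun_prop) fun η => by positivity).sub (by fun_prop)
  | _ => simp only [linkLoss]; fun_prop

lemma Regression.continuous_loss (m : Regression) (x : EuclideanSpace ℝ (Fin d)) (y : ℝ) :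
    Continuous fun θ => m.loss x y θ := by
  simp only [loss_eq_linkLoss]
  exact (m.continuous_linkLoss y).comp
    (continuous_linearPredictor.comp (Continuous.prodMk continuous_id continuous_const))

lemma measurable_log_factorial_floor :
    Measurable fun y : ℝ => Real.log (Nat.factorial ⌊y⌋₊ : ℝ) :=
  (measurable_of_countable fun n : ℕ => Real.log (Nat.factorial n : ℝ)).comp Nat.measurable_floor

lemma Regression.measurable_linkLoss (m : Regression) :
    Measurable fun p : ℝ × ℝ => m.linkLoss p.1 p.2 := by
  cases m with
  | poisson =>
    simp only [linkLoss]
    exact Measurable.add (by fun_prop) (measurable_log_factorial_floor.comp measurable_fst)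
  | _ => simp only [linkLoss]; fun_prop

lemma Regression.measurable_loss (m : Regression) (θ : Param d) :
    Measurable fun z : EuclideanSpace ℝ (Fin d) × ℝ => m.loss z.1 z.2 θ := by
  simp only [loss_eq_linkLoss]
  have h : Measurable fun z : EuclideanSpace ℝ (Fin d) × ℝ => linearPredictor θ z.1 :=
    (continuous_linearPredictor.comp
      (Continuous.prodMk continuous_const continuous_id)).measurable.comp measurable_fst
  exact m.measurable_linkLoss.comp (measurable_snd.prodMk h)

lemma Regression.continuous_lipBound (m : Regression) :
    Continuous fun p : ℝ × ℝ => m.lipBound p.1 p.2 := by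
  cases m <;> simp only [lipBound] <;> fun_prop

lemma Regression.continuous_feature (m : Regression) (R : ℝ) :
    Continuous (m.feature R : EuclideanSpace ℝ (Fin d) × ℝ → _) := by
  unfold feature
  have h : Continuous fun z : EuclideanSpace ℝ (Fin d) × ℝ => (z.2, R * (1 + ‖z.1‖)) := by fun_prop
  refine Continuous.smul (m.continuous_lipBound.comp h) ?_
  exact (WithLp.prod_continuous_toLp 2 ℝ (EuclideanSpace ℝ (Fin d))).comp
    (Continuous.prodMk continuous_const continuous_fst)

end Loss

/-! ### Compactness of the parameter spaces -/

section Constraint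

variable {d : ℕ}

lemma Constraint.continuous_size (c : Constraint) :
    Continuous (c.size : EuclideanSpace ℝ (Fin d) → ℝ) := by
  change Continuous fun β : EuclideanSpace ℝ (Fin d) => c.size β
  cases c <;> simp only [size] <;> fun_prop

lemma norm_le_sum_abs (β : EuclideanSpace ℝ (Fin d)) : ‖β‖ ≤ ∑ i, |β i| := by
  rw [EuclideanSpace.norm_eq, Real.sqrt_le_left (Finset.sum_nonneg fun _ _ => abs_nonneg _)]
  exact Finset.sum_sq_le_sq_sum_of_nonneg fun _ _ => abs_nonneg _

lemma Constraint.exists_norm_le (c : Constraint) (k : ℝ) :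
    ∃ C : ℝ, ∀ β : EuclideanSpace ℝ (Fin d), c.size β ≤ k → ‖β‖ ≤ C := by
  cases c with
  | lasso => exact ⟨k, fun β h => (norm_le_sum_abs β).trans h⟩
  | ridge => exact ⟨k, fun β h => h⟩
  | elasticNet α =>
    have h0 : (0 : ℝ) < α := α.2.1
    have h1 : (α : ℝ) < 1 := α.2.2
    refine ⟨k / α, fun β h => (le_div_iff₀ h0).2 ?_⟩
    simp only [size] at h
    have h2 : 0 ≤ (1 - (α : ℝ)) * ‖β‖ ^ 2 := mul_nonneg (by linarith) (sq_nonneg _)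
    have h3 := mul_le_mul_of_nonneg_left (norm_le_sum_abs β) h0.le
    linarith

lemma isCompact_paramSpace (c : Constraint) {U : Set ℝ} (hU : IsCompact U) (k : ℝ) :
    IsCompact (paramSpace c U k : Set (Param d)) := by
  obtain ⟨C, hC⟩ := c.exists_norm_le (d := d) k
  have h : IsCompact {β : EuclideanSpace ℝ (Fin d) | c.size β ≤ k} :=
    (isCompact_closedBall 0 C).of_isClosed_subset
      (isClosed_le c.continuous_size continuous_const) fun β hβ => by
        simpa using hC β hβ
  exact hU.prod h

lemma paramSpace_nonempty (c : Constraint) {U : Set ℝ} (hU : U.Nonempty) {k : ℝ} (hk : 0 ≤ k) :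
    (paramSpace c U k : Set (Param d)).Nonempty := by
  obtain ⟨u, hu⟩ := hU
  refine ⟨(u, 0), hu, ?_⟩
  cases c <;> simpa [Constraint.size] using hk

lemma paramSpace_mono (c : Constraint) (U : Set ℝ) {k l : ℝ} (h : k ≤ l) :
    (paramSpace c U k : Set (Param d)) ⊆ paramSpace c U l :=
  fun _ hθ => ⟨hθ.1, hθ.2.trans h⟩

lemma lowerSemicontinuousOn_minOver_paramSpace (c : Constraint) {U : Set ℝ} (hU : IsCompact U)
    (hU' : U.Nonempty) {a b : ℝ} (ha : 0 ≤ a) {f : Param d → ℝ} (hf : Continuous f) :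
    LowerSemicontinuousOn (fun k => minOver (paramSpace c U k) f) (Set.Icc a b) :=
  lowerSemicontinuousOn_minOver (W := {θ : Param d | θ.1 ∈ U}) (g := fun θ => c.size θ.2)
    (c.continuous_size.comp continuous_snd) hf (fun k _ => isCompact_paramSpace c hU k)
    (fun _ hk => paramSpace_nonempty c hU' (ha.trans hk.1))

end Constraint

end PanIC

namespace PanIC

/-! ### Integrability from the moment conditions -/

section Moments

variable {d : ℕ} {Ω : Type*} [MeasurableSpace Ω] {μ : Measure Ω}
  {X : Ω → EuclideanSpace ℝ (Fin d)} {Y : Ω → ℝ}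

/-- Fernique's theorem gives integrability of `exp (C‖X‖²)` for some `C > 0`, and completing the
square absorbs the linear exponent. -/
lemma integrable_exp_mul_norm_of_gaussian (hX : Measurable X) (h : HasGaussianLaw X μ) (s : ℝ) :
    Integrable (fun ω => Real.exp (s * ‖X ω‖)) μ := by
  have := h.isGaussian_map
  obtain ⟨C, hC, hint⟩ := IsGaussian.exists_integrable_exp_sq (μ.map X)
  rw [integrable_map_measure (by fun_prop) hX.aemeasurable] at hint
  refine (hint.const_mul (Real.exp (s ^ 2 / (4 * C)))).mono' (by fun_prop)
    (Eventually.of_forall fun ω => ?_)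
  simp only [Real.norm_eq_abs, Real.abs_exp, Function.comp]
  rw [← Real.exp_add, Real.exp_le_exp]
  have h1 : s ^ 2 / (4 * C) + C * ‖X ω‖ ^ 2 - s * ‖X ω‖ = C * (‖X ω‖ - s / (2 * C)) ^ 2 := by
    field_simp; ring
  have h2 : 0 ≤ C * (‖X ω‖ - s / (2 * C)) ^ 2 := by positivity
  linarith

variable [IsProbabilityMeasure μ]

/-- The sum is at most `d` times its largest term, and the two signs of that coordinate are covered
separately; the summand `1` is needed for `d = 0`. It reduces exponential moments of the norm to
one-dimensional marginals. -/
lemma exp_sum_abs_le (z : Fin d → ℝ) {s : ℝ} (hs : 0 ≤ s) :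
    Real.exp (s * ∑ i, |z i|) ≤
      1 + ∑ i, (Real.exp (s * d * z i) + Real.exp (-(s * d) * z i)) := by
  have hnn : ∀ i ∈ Finset.univ, 0 ≤ Real.exp (s * d * z i) + Real.exp (-(s * d) * z i) :=
    fun i _ => by positivity
  rcases isEmpty_or_nonempty (Fin d) with hd | hd
  · simp
  · obtain ⟨i, -, hi⟩ := Finset.exists_max_image Finset.univ (fun i => |z i|) Finset.univ_nonempty
    have h1 : ∑ j, |z j| ≤ d * |z i| := by
      have := Finset.sum_le_card_nsmul Finset.univ (fun j => |z j|) (|z i|) hi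
      simpa using this
    have h2 : Real.exp (s * ∑ j, |z j|) ≤ Real.exp (s * d * z i) + Real.exp (-(s * d) * z i) := by
      have h3 : s * ∑ j, |z j| ≤ s * d * |z i| := by
        rw [mul_assoc]; exact mul_le_mul_of_nonneg_left h1 hs
      refine (Real.exp_le_exp.2 h3).trans ?_
      rcases abs_cases (z i) with ⟨h, -⟩ | ⟨h, -⟩ <;> rw [h]
      · linarith [Real.exp_pos (-(s * d) * z i)]
      · rw [mul_neg, neg_mul]
        linarith [Real.exp_pos (s * d * z i)]
    have h4 := Finset.single_le_sum hnn (Finset.mem_univ i)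
    linarith

lemma integrable_exp_mul_norm_of_subGaussian (hX : Measurable X) (h : IsSubGaussianVector X μ)
    {s : ℝ} (hs : 0 ≤ s) : Integrable (fun ω => Real.exp (s * ‖X ω‖)) μ := by
  obtain ⟨c, hc⟩ := h
  set e := ∫ ω', X ω' ∂μ
  have hcoord : ∀ (i : Fin d) (t : ℝ), Integrable (fun ω => Real.exp (t * (X ω - e) i)) μ := by
    intro i t
    have := (hc (EuclideanSpace.single i 1) (by simp)).integrable_exp_mul t
    simpa [EuclideanSpace.inner_single_left] using this
  have hbound : Integrable (fun ω => Real.exp (s * ‖e‖) * (1 + ∑ i,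
      (Real.exp (s * d * (X ω - e) i) + Real.exp (-(s * d) * (X ω - e) i)))) μ :=
    ((integrable_const _).add (integrable_finsetSum _ fun i _ =>
      (hcoord i _).add (hcoord i _))).const_mul _
  refine hbound.mono' (by fun_prop) (Eventually.of_forall fun ω => ?_)
  rw [Real.norm_eq_abs, Real.abs_exp]
  refine le_trans ?_ (mul_le_mul_of_nonneg_left (exp_sum_abs_le _ hs) (Real.exp_pos _).le)
  rw [← Real.exp_add, Real.exp_le_exp, ← mul_add]
  refine mul_le_mul_of_nonneg_left ?_ hs
  have h1 := norm_le_sum_abs (X ω - e)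
  have h2 := norm_add_le e (X ω - e)
  rw [add_sub_cancel] at h2
  linarith

lemma integrable_exp_mul_norm (hX : Measurable X)
    (h : HasGaussianLaw X μ ∨ IsSubGaussianVector X μ) {s : ℝ} (hs : 0 ≤ s) :
    Integrable (fun ω => Real.exp (s * ‖X ω‖)) μ :=
  h.elim (fun h => integrable_exp_mul_norm_of_gaussian hX h s)
    fun h => integrable_exp_mul_norm_of_subGaussian hX h hs

lemma one_add_sq_le_exp {x : ℝ} (hx : 0 ≤ x) : 1 + x ^ 2 ≤ Real.exp (2 * x) := by
  have h := Real.add_one_le_exp x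
  have h2 : Real.exp (2 * x) = Real.exp x ^ 2 := by rw [← Real.exp_nat_mul]; norm_num
  rw [h2]
  nlinarith

lemma one_add_sq_sq_le_exp {x : ℝ} (hx : 0 ≤ x) : (1 + x ^ 2) ^ 2 ≤ Real.exp (4 * x) := by
  have h2 : Real.exp (4 * x) = Real.exp (2 * x) ^ 2 := by
    rw [← Real.exp_nat_mul]; congr 1; push_cast; ring
  rw [h2]
  exact pow_le_pow_left₀ (by positivity) (one_add_sq_le_exp hx) 2

/-- The squared norm is `lipBound² (1 + ‖X‖²)`. In the linear, Poisson and Gamma cases Young's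
inequality splits the mixed terms into `|Y|⁴` plus a function of `‖X‖` alone: a quartic, or
exponentials. In the logistic case `|Y| ≤ 1` leaves only `‖X‖²`. -/
lemma Regression.integrable_norm_feature_sq (m : Regression) (hX : Measurable X)
    (hY : Measurable Y) (hresp : ∀ᵐ ω ∂μ, Y ω ∈ m.responseSpace)
    (hmom : m.MomentConditions X Y μ) {R : ℝ} (hR : 0 ≤ R) :
    Integrable (fun ω => ‖m.feature R (X ω, Y ω)‖ ^ 2) μ := by
  have hm : AEStronglyMeasurable (fun ω => ‖m.feature R (X ω, Y ω)‖ ^ 2) μ :=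
    (((m.continuous_feature R).norm.pow 2).measurable.comp
      (hX.prodMk hY)).aestronglyMeasurable
  cases m with
  | linear =>
    obtain ⟨h1, h2⟩ := hmom
    have hb : Integrable (fun ω => 4 * |Y ω| ^ 4 +
        (4 + 16 * R ^ 2) * (2 + 2 * ‖X ω‖ ^ 4)) μ :=
      (h2.const_mul 4).add (((integrable_const _).add (h1.const_mul 2)).const_mul _)
    refine hb.mono' hm (Eventually.of_forall fun ω => ?_)
    rw [norm_feature_sq, Real.norm_of_nonneg (by positivity)]
    simp only [lipBound]
    have hx := norm_nonneg (X ω)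
    have hy := abs_nonneg (Y ω)
    set x := ‖X ω‖
    set y := |Y ω|
    have e1 : (y + R * (1 + x)) ^ 2 ≤ 2 * y ^ 2 + 2 * R ^ 2 * (2 * (1 + x ^ 2)) := by
      nlinarith [sq_nonneg (y - R * (1 + x)), mul_nonneg (sq_nonneg R) (sq_nonneg (1 - x))]
    have e2 : 8 * (y ^ 2 * (1 + x ^ 2)) ≤ 4 * y ^ 4 + 4 * (1 + x ^ 2) ^ 2 := by
      nlinarith [sq_nonneg (y ^ 2 - (1 + x ^ 2))]
    have e3 : (1 + x ^ 2) ^ 2 ≤ 2 + 2 * x ^ 4 := by nlinarith [sq_nonneg (1 - x ^ 2)]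
    calc (2 * (y + R * (1 + x))) ^ 2 * (1 + x ^ 2)
        = 4 * (1 + x ^ 2) * (y + R * (1 + x)) ^ 2 := by ring
      _ ≤ 4 * (1 + x ^ 2) * (2 * y ^ 2 + 2 * R ^ 2 * (2 * (1 + x ^ 2))) := by gcongr
      _ = 8 * (y ^ 2 * (1 + x ^ 2)) + 16 * R ^ 2 * (1 + x ^ 2) ^ 2 := by ring
      _ ≤ 4 * y ^ 4 + 4 * (1 + x ^ 2) ^ 2 + 16 * R ^ 2 * (1 + x ^ 2) ^ 2 := by gcongr
      _ = 4 * y ^ 4 + (4 + 16 * R ^ 2) * (1 + x ^ 2) ^ 2 := by ring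
      _ ≤ _ := by gcongr
  | logistic =>
    have hb : Integrable (fun ω => 4 * (1 + ‖X ω‖ ^ 2)) μ :=
      ((integrable_const _).add hmom).const_mul 4
    refine hb.mono' hm ?_
    filter_upwards [hresp] with ω hω
    have hy : |Y ω| ≤ 1 := by
      rcases hω with h | h
      · simp [h]
      · rw [Set.mem_singleton_iff] at h; simp [h]
    rw [norm_feature_sq, Real.norm_of_nonneg (by positivity)]
    simp only [lipBound]
    have : (1 + |Y ω|) ^ 2 ≤ 4 := by nlinarith [abs_nonneg (Y ω)]
    gcongr
  | poisson =>
    obtain ⟨h1, h2⟩ := hmom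
    have hb : Integrable (fun ω => |Y ω| ^ 4 + Real.exp (4 * ‖X ω‖) +
        2 * Real.exp (2 * R) * Real.exp ((2 * R + 2) * ‖X ω‖)) μ :=
      (h2.add (integrable_exp_mul_norm hX h1 (by norm_num))).add
        ((integrable_exp_mul_norm hX h1 (by positivity)).const_mul _)
    refine hb.mono' hm (Eventually.of_forall fun ω => ?_)
    rw [norm_feature_sq, Real.norm_of_nonneg (by positivity)]
    simp only [lipBound]
    have hx := norm_nonneg (X ω)
    have hy := abs_nonneg (Y ω)
    set x := ‖X ω‖
    set y := |Y ω|
    set E := Real.exp (R * (1 + x)) with hE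
    have e1 : (y + E) ^ 2 ≤ 2 * y ^ 2 + 2 * E ^ 2 := by nlinarith [sq_nonneg (y - E)]
    have e2 : 2 * (y ^ 2 * (1 + x ^ 2)) ≤ y ^ 4 + (1 + x ^ 2) ^ 2 := by
      nlinarith [sq_nonneg (y ^ 2 - (1 + x ^ 2))]
    have e3 : Real.exp (2 * R) * Real.exp ((2 * R + 2) * x) = E ^ 2 * Real.exp (2 * x) := by
      rw [hE, ← Real.exp_nat_mul, ← Real.exp_add, ← Real.exp_add]; congr 1; push_cast; ring
    calc (y + E) ^ 2 * (1 + x ^ 2)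
        ≤ (2 * y ^ 2 + 2 * E ^ 2) * (1 + x ^ 2) := by gcongr
      _ = 2 * (y ^ 2 * (1 + x ^ 2)) + 2 * (E ^ 2 * (1 + x ^ 2)) := by ring
      _ ≤ (y ^ 4 + Real.exp (4 * x)) + 2 * (E ^ 2 * Real.exp (2 * x)) := by
        have f1 := one_add_sq_sq_le_exp hx
        have f2 := mul_le_mul_of_nonneg_left (one_add_sq_le_exp hx) (sq_nonneg E)
        linarith
      _ = _ := by rw [← e3]; ring
  | gamma ν =>
    obtain ⟨h1, h2, -⟩ := hmom
    have hb : Integrable (fun ω => (ν : ℝ) ^ 2 * (2 * Real.exp (2 * ‖X ω‖) + |Y ω| ^ 4 +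
        Real.exp (4 * R) * Real.exp ((4 * R + 4) * ‖X ω‖))) μ :=
      ((((integrable_exp_mul_norm hX h1 (by norm_num)).const_mul _).add h2).add
        ((integrable_exp_mul_norm hX h1 (by positivity)).const_mul _)).const_mul _
    refine hb.mono' hm (Eventually.of_forall fun ω => ?_)
    rw [norm_feature_sq, Real.norm_of_nonneg (by positivity)]
    simp only [lipBound]
    have hx := norm_nonneg (X ω)
    have hy := abs_nonneg (Y ω)
    set x := ‖X ω‖
    set y := |Y ω|
    set E := Real.exp (R * (1 + x)) with hE
    have e1 : (1 + y * E) ^ 2 ≤ 2 + 2 * (y * E) ^ 2 := by nlinarith [sq_nonneg (1 - y * E)]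
    have e2 : 2 * (y ^ 2 * (E ^ 2 * (1 + x ^ 2))) ≤ y ^ 4 + (E ^ 2 * (1 + x ^ 2)) ^ 2 := by
      nlinarith [sq_nonneg (y ^ 2 - (E ^ 2 * (1 + x ^ 2)))]
    have e3 : Real.exp (4 * R) * Real.exp ((4 * R + 4) * x) = E ^ 4 * Real.exp (4 * x) := by
      rw [hE, ← Real.exp_nat_mul, ← Real.exp_add, ← Real.exp_add]; congr 1; push_cast; ring
    rw [mul_pow, mul_assoc]
    refine mul_le_mul_of_nonneg_left ?_ (sq_nonneg _)
    calc (1 + y * E) ^ 2 * (1 + x ^ 2)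
        ≤ (2 + 2 * (y * E) ^ 2) * (1 + x ^ 2) := by gcongr
      _ = 2 * (1 + x ^ 2) + 2 * (y ^ 2 * (E ^ 2 * (1 + x ^ 2))) := by ring
      _ ≤ 2 * (1 + x ^ 2) + (y ^ 4 + (E ^ 2 * (1 + x ^ 2)) ^ 2) := by gcongr
      _ = 2 * (1 + x ^ 2) + y ^ 4 + E ^ 4 * (1 + x ^ 2) ^ 2 := by ring
      _ ≤ 2 * Real.exp (2 * x) + y ^ 4 + E ^ 4 * Real.exp (4 * x) := by
        gcongr
        · exact one_add_sq_le_exp hx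
        · exact one_add_sq_sq_le_exp hx
      _ = _ := by rw [← e3]

lemma integrable_sq_of_integrable_pow_four (hY : Measurable Y)
    (h : Integrable (fun ω => |Y ω| ^ 4) μ) : Integrable (fun ω => Y ω ^ 2) μ := by
  refine ((integrable_const 1).add h).mono' (by fun_prop) (Eventually.of_forall fun ω => ?_)
  have h4 : |Y ω| ^ 4 = (Y ω ^ 2) ^ 2 := by rw [← sq_abs (Y ω)]; ring
  simp only [Real.norm_eq_abs, abs_of_nonneg (sq_nonneg (Y ω)), Pi.add_apply, h4]
  nlinarith [sq_nonneg (Y ω ^ 2 - 1)]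

lemma log_factorial_le_sq (n : ℕ) : Real.log (Nat.factorial n : ℝ) ≤ (n : ℝ) ^ 2 := by
  have h1 : (Nat.factorial n : ℝ) ≤ (n : ℝ) ^ n := by exact_mod_cast Nat.factorial_le_pow n
  calc Real.log (Nat.factorial n : ℝ) ≤ Real.log ((n : ℝ) ^ n) :=
        Real.log_le_log (by exact_mod_cast Nat.factorial_pos n) h1
    _ = n * Real.log n := Real.log_pow _ _
    _ ≤ n * n := by
        gcongr
        exact Real.log_le_self (Nat.cast_nonneg n)
    _ = (n : ℝ) ^ 2 := by ring

lemma Regression.integrable_linkLoss_zero (m : Regression) (hY : Measurable Y)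
    (hresp : ∀ᵐ ω ∂μ, Y ω ∈ m.responseSpace) (hmom : m.MomentConditions X Y μ) :
    Integrable (fun ω => m.linkLoss (Y ω) 0) μ := by
  cases m with
  | linear =>
    simpa [linkLoss] using integrable_sq_of_integrable_pow_four hY hmom.2
  | logistic => simp [linkLoss]
  | poisson =>
    have h2 := integrable_sq_of_integrable_pow_four hY hmom.2
    simp only [linkLoss, Real.exp_zero, mul_zero, sub_zero]
    refine (integrable_const _).add (h2.mono'
      (measurable_log_factorial_floor.comp hY).aestronglyMeasurable ?_)
    filter_upwards [hresp] with ω hω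
    obtain ⟨j, hj⟩ := hω
    simp only at hj
    rw [← hj, Nat.floor_natCast, Real.norm_of_nonneg
      (Real.log_nonneg (by exact_mod_cast Nat.one_le_iff_ne_zero.2 (Nat.factorial_ne_zero j)))]
    exact log_factorial_le_sq j
  | gamma ν =>
    obtain ⟨-, h2, h3⟩ := hmom
    have h2' := integrable_sq_of_integrable_pow_four hY h2
    have hY1 : Integrable Y μ :=
      ((memLp_two_iff_integrable_sq hY.aestronglyMeasurable).2 h2').integrable one_le_two
    simp only [linkLoss, mul_zero, neg_zero, Real.exp_zero, mul_one, zero_add]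
    refine (hY1.mul_const _).sub ?_
    -- For `ν = 1` the coefficient of `log Y` vanishes, so its integrability is not needed.
    by_cases hν : (ν : ℝ) = 1
    · simp [hν]
    · exact (h3 hν).const_mul _

lemma Regression.integrable_loss (m : Regression) (hX : Measurable X)
    (hY : Measurable Y) (hresp : ∀ᵐ ω ∂μ, Y ω ∈ m.responseSpace)
    (hmom : m.MomentConditions X Y μ) (θ : Param d) :
    Integrable (fun ω => m.loss (X ω) (Y ω) θ) μ := by
  refine ((m.integrable_linkLoss_zero hY hresp hmom).abs.add
    (((m.integrable_norm_feature_sq hX hY hresp hmom (norm_nonneg θ)).add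
      (integrable_const 1)).const_mul ‖θ‖)).mono'
    ((m.measurable_loss θ).comp (hX.prodMk hY)).aestronglyMeasurable
    (Eventually.of_forall fun ω => ?_)
  exact m.abs_loss_le (norm_nonneg θ) le_rfl (X ω, Y ω)

lemma Regression.continuous_expectedRisk (m : Regression) (hX : Measurable X)
    (hY : Measurable Y) (hresp : ∀ᵐ ω ∂μ, Y ω ∈ m.responseSpace)
    (hmom : m.MomentConditions X Y μ) : Continuous (expectedRisk m X Y μ) := by
  refine continuous_iff_continuousAt.2 fun θ₀ => ?_
  -- Radius of a ball containing the unit ball around `θ₀`, on which a single dominating function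
  -- works.
  have hR : 0 ≤ ‖θ₀‖ + 1 := by positivity
  refine continuousAt_of_dominated (F := fun θ ω => m.loss (X ω) (Y ω) θ)
    (bound := fun ω => |m.linkLoss (Y ω) 0| +
      (‖θ₀‖ + 1) * (‖m.feature (‖θ₀‖ + 1) (X ω, Y ω)‖ ^ 2 + 1)) ?_ ?_ ?_ ?_
  · exact Eventually.of_forall fun θ =>
      ((m.measurable_loss θ).comp (hX.prodMk hY)).aestronglyMeasurable
  · filter_upwards [Metric.ball_mem_nhds θ₀ one_pos] with θ hθ
    refine Eventually.of_forall fun ω => m.abs_loss_le hR ?_ (X ω, Y ω)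
    have h1 := norm_le_norm_add_norm_sub' θ θ₀
    rw [mem_ball_iff_norm] at hθ
    linarith
  · exact (m.integrable_linkLoss_zero hY hresp hmom).abs.add
      (((m.integrable_norm_feature_sq hX hY hresp hmom hR).add
        (integrable_const 1)).const_mul _)
  · exact Eventually.of_forall fun ω => (m.continuous_loss (X ω) (Y ω)).continuousAt

end Moments

end PanIC

namespace PanIC

/-! ### From the deviation bound to consistency -/

section Consistency

lemma continuous_empiricalRisk {d : ℕ} {Ω : Type*} (m : Regression)
    (X : ℕ → Ω → EuclideanSpace ℝ (Fin d)) (Y : ℕ → Ω → ℝ) (n : ℕ) (ω : Ω) :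
    Continuous (empiricalRisk m X Y n ω) :=
  continuous_const.mul (continuous_finsetSum _ fun i _ => m.continuous_loss (X i ω) (Y i ω))

/-- A penalized minimizer is close to `k₀` when the criterion is close to `r` and the penalty
is small, but larger than the error over the indices above `k₀`. -/
lemma abs_sub_lt_of_mem_argminIcc {S : Type*} [TopologicalSpace S] {T : ℝ → Set S}
    (hTc : ∀ k, IsCompact (T k)) {a b : ℝ} (hTne : ∀ k ∈ Set.Icc a b, (T k).Nonempty)
    (hTm : ∀ ⦃k l⦄, k ≤ l → T k ⊆ T l) {f r : S → ℝ} (hf : Continuous f) {p : ℝ → ℝ}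
    (hpa : 0 < p a) (hp : StrictMonoOn p (Set.Icc a b)) {k₀ : ℝ} (hk₀ : k₀ ∈ Set.Icc a b)
    {θ₀ : S} (hθ₀ : θ₀ ∈ T k₀) {ε δ η : ℝ} (hε : 0 < ε)
    (hr : ∀ k ∈ Set.Icc a b, k ≤ k₀ - ε → ∀ θ ∈ T k, r θ₀ + δ ≤ r θ)
    (hr₀ : ∀ θ ∈ T b, r θ₀ ≤ r θ)
    (hfr : ∀ θ ∈ T b, r θ - r θ₀ - η ≤ f θ - f θ₀) (hsmall : p k₀ + η ≤ δ)
    (hlarge : k₀ + ε ≤ b → η < p (k₀ + ε) - p k₀) {k : ℝ}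
    (hk : k ∈ argminIcc a b fun k => minOver (T k) f + p k) : |k - k₀| < ε := by
  obtain ⟨hkI, hmin⟩ := hk
  have hab : a ≤ b := hkI.1.trans hkI.2
  obtain ⟨θ, hθ, hθm⟩ := (hTc k).exists_isMinOn (hTne k hkI) hf.continuousOn
  have h1 : minOver (T k) f + p k ≤ minOver (T k₀) f + p k₀ := hmin hk₀
  rw [minOver_eq hθ hθm] at h1
  have h2 := minOver_le (hTc k₀) hf hθ₀
  have h3 := hfr θ (hTm hkI.2 hθ)
  rw [abs_lt]
  constructor
  -- Underestimation: the excess risk forces `p k ≤ p k₀ + η - δ ≤ 0`, against `p k ≥ p a > 0`.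
  · by_contra! hle
    have h4 := hr k hkI (by linarith) θ hθ
    have h5 : p a ≤ p k := hp.monotoneOn ⟨le_rfl, hab⟩ hkI hkI.1
    linarith
  -- Overestimation: the excess risk is only known to be nonnegative, so `p (k₀ + ε) ≤ p k ≤ p k₀ +
  -- η`, against the penalty gap.
  · by_contra! hle
    have hlb : k₀ + ε ≤ b := by linarith [hkI.2]
    have h4 := hr₀ θ (hTm hkI.2 hθ)
    have h5 : p (k₀ + ε) ≤ p k :=
      hp.monotoneOn ⟨by linarith [hk₀.1], hlb⟩ hkI (by linarith)
    linarith [hlarge hlb]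

variable {Ω : Type*} [MeasurableSpace Ω] {μ : Measure Ω} [IsProbabilityMeasure μ] {d : ℕ}
  {m : Regression} {X : ℕ → Ω → EuclideanSpace ℝ (Fin d)} {Y : ℕ → Ω → ℝ}

/-- The empirical excess risk exceeds the expected excess risk up to `O_P(n^{-1/2})`, uniformly
over a bounded set of parameters. -/
lemma exists_measure_excessRisk_le (hX : ∀ i, Measurable (X i)) (hY : ∀ i, Measurable (Y i))
    (hindep : iIndepFun (fun i ω => (X i ω, Y i ω)) μ)
    (hident : ∀ i, IdentDistrib (fun ω => (X i ω, Y i ω)) (fun ω => (X 0 ω, Y 0 ω)) μ μ)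
    (hresp : ∀ᵐ ω ∂μ, Y 0 ω ∈ m.responseSpace) (hmom : m.MomentConditions (X 0) (Y 0) μ)
    {T : Set (Param d)} (hT : Bornology.IsBounded T) {θ₀ : Param d} (hθ₀ : θ₀ ∈ T) :
    ∃ B : ℝ, ∀ n : ℕ, 1 ≤ n → ∀ M : ℝ, 0 < M →
      μ {ω | ∃ θ ∈ T, empiricalRisk m X Y n ω θ - empiricalRisk m X Y n ω θ₀ <
        expectedRisk m (X 0) (Y 0) μ θ - expectedRisk m (X 0) (Y 0) μ θ₀ - M / √n} ≤
      ENNReal.ofReal (B / M) := by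
  set Z : ℕ → Ω → EuclideanSpace ℝ (Fin d) × ℝ := fun i ω => (X i ω, Y i ω) with hZdef
  have hZ : ∀ i, Measurable (Z i) := fun i => (hX i).prodMk (hY i)
  have hlaw : ∀ i, μ.map (Z i) = μ.map (Z 0) := fun i => (hident i).map_eq
  obtain ⟨R, hR⟩ := hT.exists_norm_le
  have hR0 : 0 ≤ R := (norm_nonneg _).trans (hR θ₀ hθ₀)
  let φ : Param d → WithLp 2 (ℝ × EuclideanSpace ℝ (Fin d)) := fun θ => WithLp.toLp 2 θ
  -- `Param d` carries the sup norm of the product, `φ` the Euclidean one; the factor `2` covers the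
  -- change of norm.
  have hφ : ∀ θ ∈ T, ‖φ θ‖ ≤ 2 * R := by
    intro θ hθ
    have h1 : ‖φ θ‖ ^ 2 = ‖θ.1‖ ^ 2 + ‖θ.2‖ ^ 2 := by
      simp [φ, WithLp.prod_norm_sq_eq_of_L2]
    have h2 := (norm_fst_le θ).trans (hR θ hθ)
    have h3 := (norm_snd_le θ).trans (hR θ hθ)
    nlinarith [norm_nonneg θ.1, norm_nonneg θ.2, norm_nonneg (φ θ)]
  have hrisk : ∀ θ, ∫ z, m.loss z.1 z.2 θ ∂(μ.map (Z 0)) = expectedRisk m (X 0) (Y 0) μ θ :=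
    fun θ => integral_map (hZ 0).aemeasurable (m.measurable_loss θ).aestronglyMeasurable
  have hfeat := m.continuous_feature (d := d) R
  refine ⟨_, fun n hn M hM => le_trans (measure_mono ?_) (measure_exists_lt_le (ρ := μ.map (Z 0))
    hθ₀ hZ hindep hlaw
    (f := fun θ z => m.loss z.1 z.2 θ) m.measurable_loss (fun θ =>
      (integrable_map_measure (m.measurable_loss θ).aestronglyMeasurable
        (hZ 0).aemeasurable).2 (m.integrable_loss (hX 0) (hY 0) hresp hmom θ))
    (fun z => m.continuous_loss z.1 z.2)
    (by simp only [hrisk]; exact m.continuous_expectedRisk (hX 0) (hY 0) hresp hmom)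
    (φ := φ) hfeat.aestronglyMeasurable
    ((integrable_map_measure (hfeat.norm.pow 2).aestronglyMeasurable
        (hZ 0).aemeasurable).2 (m.integrable_norm_feature_sq (hX 0) (hY 0) hresp hmom hR0))
    (fun θ hθ θ' hθ' z => m.abs_loss_sub_le_inner hR0 (hR θ hθ) (hR θ' hθ') z) hφ hn hM)⟩
  rintro ω ⟨θ, hθ, h⟩
  refine ⟨θ, hθ, ?_⟩
  have hn0 : (0 : ℝ) < n := by exact_mod_cast hn
  have hemp : ∀ θ, ∑ k ∈ Finset.range n,
      (∫ z, m.loss z.1 z.2 θ ∂(μ.map (Z 0)) - m.loss (Z k ω).1 (Z k ω).2 θ) =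
      n * (expectedRisk m (X 0) (Y 0) μ θ - empiricalRisk m X Y n ω θ) := by
    intro θ
    rw [hrisk, Finset.sum_sub_distrib, empiricalRisk]
    simp only [Finset.sum_const, Finset.card_range, nsmul_eq_mul, hZdef]
    field_simp
  rw [hemp, hemp, ← mul_sub]
  have h1 : M * √(n : ℝ) = n * (M / √(n : ℝ)) := by
    have h2 : √(n : ℝ) ≠ 0 := (Real.sqrt_pos.2 hn0).ne'
    have h3 : √(n : ℝ) ^ 2 = n := Real.sq_sqrt hn0.le
    field_simp
    rw [h3]
  rw [h1]
  exact mul_lt_mul_of_pos_left (by linarith) hn0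

end Consistency

end PanIC

/-! ### The main theorem -/

theorem mainTheorem4 {Ω : Type*} [MeasurableSpace Ω] (μ : Measure Ω) [IsProbabilityMeasure μ]
    {d : ℕ} (m : PanIC.Regression) (c : PanIC.Constraint)
    (U : Set ℝ) (hU : IsCompact U) (hU' : U.Nonempty)
    (a b : ℝ) (ha : 0 ≤ a) (hab : a < b)
    (X : ℕ → Ω → EuclideanSpace ℝ (Fin d)) (Y : ℕ → Ω → ℝ)
    (hX : ∀ i, Measurable (X i)) (hY : ∀ i, Measurable (Y i))
    (hindep : iIndepFun (fun i ω => (X i ω, Y i ω)) μ)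
    (hident : ∀ i, IdentDistrib (fun ω => (X i ω, Y i ω)) (fun ω => (X 0 ω, Y 0 ω)) μ μ)
    (hresp : ∀ i, ∀ᵐ ω ∂μ, Y i ω ∈ m.responseSpace)
    (hmom : m.MomentConditions (X 0) (Y 0) μ)
    (P : ℝ → ℕ → Ω → ℝ) (hP : PanIC.IsPenalty μ a b P) :
    -- the expected risk is finite, and all minima in the definitions are attained
    (∀ θ : PanIC.Param d, Integrable (fun ω => m.loss (X 0 ω) (Y 0 ω) θ) μ) ∧
    (∀ k ∈ Set.Icc a b, ∃ θ ∈ PanIC.paramSpace c U k,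
      IsMinOn (PanIC.expectedRisk m (X 0) (Y 0) μ) (PanIC.paramSpace c U k) θ) ∧
    (∀ n ω, ∀ k ∈ Set.Icc a b, ∃ θ ∈ PanIC.paramSpace c U k,
      IsMinOn (PanIC.empiricalRisk m X Y n ω) (PanIC.paramSpace c U k) θ) ∧
    IsLeast (PanIC.optimalIndices m c U a b (X 0) (Y 0) μ)
      (PanIC.optimalIndex m c U a b (X 0) (Y 0) μ) ∧
    (∀ n : ℕ, 1 ≤ n → ∀ᵐ ω ∂μ, IsLeast (PanIC.panICIndices m c U a b X Y P n ω)
      (PanIC.panICEstimator m c U a b X Y P n ω)) ∧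
    -- the PanIC estimator converges in probability to the optimal index
    TendstoInMeasure μ (PanIC.panICEstimator m c U a b X Y P) atTop
      (fun _ => PanIC.optimalIndex m c U a b (X 0) (Y 0) μ) := by
  have hr := m.continuous_expectedRisk (hX 0) (hY 0) (hresp 0) hmom
  have hTc : ∀ k, IsCompact (PanIC.paramSpace c U k : Set (PanIC.Param d)) :=
    PanIC.isCompact_paramSpace c hU
  have hTne : ∀ k ∈ Set.Icc a b, (PanIC.paramSpace c U k : Set (PanIC.Param d)).Nonempty :=
    fun k hk => PanIC.paramSpace_nonempty c hU' (ha.trans hk.1)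
  have hleast : IsLeast (PanIC.optimalIndices m c U a b (X 0) (Y 0) μ)
      (PanIC.optimalIndex m c U a b (X 0) (Y 0) μ) :=
    PanIC.isLeast_argminIcc hab.le
      (PanIC.lowerSemicontinuousOn_minOver_paramSpace c hU hU' ha hr)
  have hest : ∀ n : ℕ, 1 ≤ n → ∀ᵐ ω ∂μ, IsLeast (PanIC.panICIndices m c U a b X Y P n ω)
      (PanIC.panICEstimator m c U a b X Y P n ω) := by
    intro n hn
    filter_upwards [hP.continuous_strictMono n hn] with ω hω
    exact PanIC.isLeast_argminIcc hab.le
      ((PanIC.lowerSemicontinuousOn_minOver_paramSpace c hU hU' ha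
        (PanIC.continuous_empiricalRisk m X Y n ω)).add hω.1.lowerSemicontinuousOn)
  refine ⟨m.integrable_loss (hX 0) (hY 0) (hresp 0) hmom,
    fun k hk => (hTc k).exists_isMinOn (hTne k hk) hr.continuousOn,
    fun n ω k hk => (hTc k).exists_isMinOn (hTne k hk)
      (PanIC.continuous_empiricalRisk m X Y n ω).continuousOn, hleast, hest, ?_⟩
  rw [tendstoInMeasure_iff_dist]
  intro ε hε
  set k₀ := PanIC.optimalIndex m c U a b (X 0) (Y 0) μ
  set r := PanIC.expectedRisk m (X 0) (Y 0) μ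
  obtain ⟨⟨hk₀, hmin⟩, hlow⟩ := hleast
  have haI : a ∈ Set.Icc a b := ⟨le_rfl, hab.le⟩
  have hbI : b ∈ Set.Icc a b := ⟨hab.le, le_rfl⟩
  obtain ⟨θ₀, hθ₀, hθ₀m⟩ := (hTc k₀).exists_isMinOn (hTne k₀ hk₀) hr.continuousOn
  have hval := PanIC.minOver_eq hθ₀ hθ₀m
  have hr₀ : ∀ θ ∈ PanIC.paramSpace c U b, r θ₀ ≤ r θ := fun θ hθ =>
    hval ▸ (hmin hbI).trans (PanIC.minOver_le (hTc b) hr hθ)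
  -- The index `k₀ - ε`, if it lies in `[a, b]`, is not optimal because `k₀` is the least optimal
  -- one. Its risk gap serves as `δ` for all smaller indices, whose parameter spaces are nested in
  -- its own.
  obtain ⟨δ, hδ, hgap⟩ : ∃ δ > 0, ∀ k ∈ Set.Icc a b, k ≤ k₀ - ε →
      ∀ θ ∈ PanIC.paramSpace c U k, r θ₀ + δ ≤ r θ := by
    by_cases hka : a ≤ k₀ - ε
    · have hkI : k₀ - ε ∈ Set.Icc a b := ⟨hka, by linarith [hk₀.2]⟩
      refine ⟨PanIC.minOver (PanIC.paramSpace c U (k₀ - ε)) r - r θ₀, ?_, fun k hk hle θ hθ => ?_⟩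
      · by_contra! hle
        have hmem : k₀ - ε ∈ PanIC.optimalIndices m c U a b (X 0) (Y 0) μ :=
          ⟨hkI, fun l hl => by
            have h1 : PanIC.minOver (PanIC.paramSpace c U k₀) r ≤
              PanIC.minOver (PanIC.paramSpace c U l) r := hmin hl
            change PanIC.minOver (PanIC.paramSpace c U (k₀ - ε)) r ≤
              PanIC.minOver (PanIC.paramSpace c U l) r
            linarith⟩
        linarith [hlow hmem]
      · have := PanIC.minOver_le (hTc (k₀ - ε)) hr (PanIC.paramSpace_mono c U hle hθ)
        linarith
    · exact ⟨1, one_pos, fun k hk hle => absurd (hk.1.trans hle) hka⟩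
  obtain ⟨B, hB⟩ := PanIC.exists_measure_excessRisk_le hX hY hindep hident (hresp 0) hmom
    (hTc b).isBounded (PanIC.paramSpace_mono c U hk₀.2 hθ₀)
  rw [ENNReal.tendsto_nhds_zero]
  intro e he
  have he3 : 0 < e / 3 := ENNReal.div_pos he.ne' (by norm_num)
  obtain ⟨M, hM, hMe⟩ : ∃ M : ℝ, 0 < M ∧ ENNReal.ofReal (B / M) ≤ e / 3 := by
    have h1 : Tendsto (fun M : ℝ => ENNReal.ofReal (B / M)) atTop (𝓝 0) := by
      simpa using ENNReal.tendsto_ofReal (tendsto_const_nhds.div_atTop tendsto_id)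
    exact ((eventually_gt_atTop 0).and (h1.eventually (ge_mem_nhds he3))).exists
  -- Bad event for the penalty increment, with the same `M` as in the deviation bound; it is empty
  -- when `k₀ + ε` lies outside the index interval.
  obtain ⟨A, hA, hAl⟩ : ∃ A : ℕ → Set Ω, Tendsto (fun n => μ (A n)) atTop (𝓝 0) ∧
      ∀ n ω, ω ∉ A n → k₀ + ε ≤ b → M < √n * (P (k₀ + ε) n ω - P k₀ n ω) := by
    by_cases hb : k₀ + ε ≤ b
    · refine ⟨fun n => {ω | √n * (P (k₀ + ε) n ω - P k₀ n ω) ≤ M},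
        hP.increments k₀ hk₀ (k₀ + ε) ⟨by linarith [hk₀.1], hb⟩ (by linarith) M,
        fun n ω h _ => ?_⟩
      simpa using h
    · exact ⟨fun _ => ∅, by simp, fun n ω _ h => absurd h hb⟩
  have hPz := tendstoInMeasure_iff_dist.1 (hP.tendsto_zero k₀ hk₀) (δ / 2) (by positivity)
  have hrate : Tendsto (fun n : ℕ => M / √(n : ℝ)) atTop (𝓝 0) :=
    tendsto_const_nhds.div_atTop (Real.tendsto_sqrt_atTop.comp tendsto_natCast_atTop_atTop)
  filter_upwards [ENNReal.tendsto_nhds_zero.1 hA _ he3, ENNReal.tendsto_nhds_zero.1 hPz _ he3,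
    hrate.eventually (gt_mem_nhds (half_pos hδ)), eventually_ge_atTop 1] with n hn1 hn2 hn3 hn
  have hsum : e / 3 + e / 3 + e / 3 = e := ENNReal.add_thirds e
  rw [← hsum]
  refine le_trans ?_ (add_le_add (add_le_add ((hB n hn M hM).trans hMe) hn2) hn1)
  -- Up to a null set, an error of at least `ε` lies in the union of three bad events: large risk
  -- deviation, penalty at `k₀` of size at least `δ / 2`, small penalty increment.
  refine le_trans (measure_mono_ae ?_)
    ((measure_union_le _ _).trans (add_le_add (measure_union_le _ _) le_rfl))
  filter_upwards [hP.continuous_strictMono n hn, hP.pos a haI n hn, hest n hn]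
    with ω hmono hpos hω hdist
  by_contra hnot
  obtain ⟨hnot', hlarge⟩ := not_or.1 hnot
  obtain ⟨hgood, hsmall⟩ := not_or.1 hnot'
  have hn0 : (0 : ℝ) < √(n : ℝ) := Real.sqrt_pos.2 (by exact_mod_cast hn)
  have hsmall' : P k₀ n ω < δ / 2 := by
    have h1 : |P k₀ n ω| < δ / 2 := by
      have h2 : ¬ δ / 2 ≤ dist (P k₀ n ω) 0 := hsmall
      rwa [not_le, Real.dist_0_eq_abs] at h2
    exact (le_abs_self _).trans_lt h1
  refine absurd (PanIC.abs_sub_lt_of_mem_argminIcc hTc hTne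
    (fun _ _ h => PanIC.paramSpace_mono c U h) (PanIC.continuous_empiricalRisk m X Y n ω)
    (p := fun k => P k n ω) (η := M / √(n : ℝ)) hpos hmono.2 hk₀ hθ₀ hε hgap hr₀
    (fun θ hθ => ?_) (by linarith) (fun hb => ?_) hω.1) (not_lt.2 hdist)
  · by_contra! h
    exact hgood ⟨θ, hθ, h⟩
  · rw [div_lt_iff₀ hn0, mul_comm]
    exact hAl n ω hlarge hb
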